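/- Let $Q$ be a non-degenerate symmetric bilinear form and $V$ a totally symmetric trilinear form on $\mathbb{R}^N$, with components $V_{jkl}$ in the standard basis, and let $(Q^{jk})$ be the inverse of the matrix of $Q$. For a polynomial $P$ and a non-degenerate symmetric form $Q'$, the oscillatory integral $\int_{\mathbb{R}^N}e^{\frac i2Q'(x,x)}P(x)\,d^Nx$ is defined by analytic continuation, as the limit for $\varepsilon\to0^+$ of the absolutely convergent integrals $\int_{\mathbb{R}^N}e^{\frac i2(Q'(x,x)+i\varepsilon|x|^2)}P(x)\,d^Nx$. Put $Z(0)=\int_{\mathbb{R}^N}e^{\frac i2Q(x,x)}\,d^Nx$. The formal integral $$Z_k=\int_{\mathbb{R}^N}e^{ik\left(\frac12Q(x,x)+\frac16V(x,x,x)\right)}\,d^Nx\qquad(k>0)$$ is the formal series obtained by expanding $e^{\frac{ik}{6}V(x,x,x)}$ into its power series and integrating term by term, i.e. the sum over $j\ge0$ of the terms $\int_{\mathbb{R}^N}e^{\frac{ik}2Q(x,x)}\frac{1}{j!}\left(\frac{ik}{6}V(x,x,x)\right)^j\,d^Nx$. A trivalent graph $\Gamma$ is a finite set of half-edges with a partition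 into two-element subsets (edges) and a partition into three-element subsets (vertices); loops, multiple edges and disconnected or empty graphs are allowed. An isomorphism is a bijection of the half-edges that preserves both partitions, $\operatorname{Aut}\Gamma$ is the group of automorphisms, and a graph is connected if it is non-empty and any two half-edges are joined by a chain in which successive half-edges lie on a common edge or at a common vertex. The weight $W(\Gamma)$ is obtained by labeling the half-edges with indices in $\{1,\dots,N\}$, putting $V_{jkl}$ at each vertex and $Q^{jk}$ on each edge with the indices of its half-edges, and summing the product over all labelings. Then all the integrals above exist, $Z(0)\neq0$, the $j$-th term of $Z_k$ vanishes for odd $j$ and, for $j=2m$, is $k^{-N/2-m}$ times a constant, and $$Z_k=\sum_{m=0}^\infty i^mZ(0)\,k^{-\frac N2-m}\sum_{\Gamma}\frac{W(\Gamma)}{|\operatorname{Aut}\Gamma|}$$ as formal series, where $\Gamma$ runs over the isomorphism classes of trivalent graphs with $2m$ vertices. If the legs of $2m$ fixed trivalent vertices are glued in pairs, then each trivalent graph $\Gamma$ with $2m$ vertices arises from exactly $(2m)!\,6^{2m}/|\operatorname{Aut}\Gamma|$ of the pairings. Moreover, as formal series, $$\log\left(\frac{Z_k}{Z(0)}\right)=-\frac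 N2\log k+\sum_{m=0}^\infty i^mk^{-m}\sum_{\Gamma\text{ connected}}\frac{W(\Gamma)}{|\operatorname{Aut}\Gamma|},$$ where $\Gamma$ runs over the isomorphism classes of connected trivalent graphs with $2m$ vertices. -/

import Mathlib

open Filter Topology MeasureTheory
open scoped PowerSeries

noncomputable section

namespace FeynmanModel

/-! ### Trivalent graphs -/

/-- A trivalent graph with set of half-edges `H`: a partition of `H` into two-element subsets (the
edges) and a partition of `H` into three-element subsets (the vertices). Loops, multiple edges and
disconnected (also empty) graphs are allowed. -/
structure TrivalentGraph (H : Type*) where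
  edges : Finset (Finset H)
  vertices : Finset (Finset H)
  card_of_mem_edges : ∀ e ∈ edges, e.card = 2
  card_of_mem_vertices : ∀ v ∈ vertices, v.card = 3
  existsUnique_edge : ∀ h : H, ∃! e, e ∈ edges ∧ h ∈ e
  existsUnique_vertex : ∀ h : H, ∃! v, v ∈ vertices ∧ h ∈ v

namespace TrivalentGraph

variable {H K L : Type*}

/-- A bijection between half-edges is an isomorphism of trivalent graphs if it carries the edges
onto the edges and the vertices onto the vertices. -/
def IsIso (Γ : TrivalentGraph H) (Δ : TrivalentGraph K) (σ : H ≃ K) : Prop :=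
  (∀ s : Finset H, s ∈ Γ.edges ↔ s.map σ.toEmbedding ∈ Δ.edges) ∧
    (∀ s : Finset H, s ∈ Γ.vertices ↔ s.map σ.toEmbedding ∈ Δ.vertices)

theorem IsIso.refl (Γ : TrivalentGraph H) : Γ.IsIso Γ (Equiv.refl H) := by
  constructor <;> intro s <;> simp

theorem IsIso.symm {Γ : TrivalentGraph H} {Δ : TrivalentGraph K} {σ : H ≃ K}
    (h : Γ.IsIso Δ σ) : Δ.IsIso Γ σ.symm := by
  constructor <;> intro s
  · rw [h.1, Finset.map_map]; simp
  · rw [h.2, Finset.map_map]; simp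

theorem IsIso.trans {Γ : TrivalentGraph H} {Δ : TrivalentGraph K} {Θ : TrivalentGraph L}
    {σ : H ≃ K} {τ : K ≃ L} (h : Γ.IsIso Δ σ) (h' : Δ.IsIso Θ τ) :
    Γ.IsIso Θ (σ.trans τ) := by
  constructor <;> intro s
  · rw [h.1, h'.1, Finset.map_map]; rfl
  · rw [h.2, h'.2, Finset.map_map]; rfl

/-- The automorphism group: permutations of the half-edges preserving both partitions. -/
def Aut (Γ : TrivalentGraph H) : Subgroup (Equiv.Perm H) where
  carrier := {σ | Γ.IsIso Γ σ}
  one_mem' := IsIso.refl Γ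
  mul_mem' := fun ha hb => IsIso.trans hb ha
  inv_mem' := fun ha => IsIso.symm ha

/-- A trivalent graph is connected if it is non-empty and any two half-edges are joined by a chain
in which successive half-edges lie on a common edge or at a common vertex. -/
def Connected (Γ : TrivalentGraph H) : Prop :=
  Nonempty H ∧ ∀ a b : H,
    Relation.ReflTransGen
      (fun x y => ∃ s : Finset H, (s ∈ Γ.edges ∨ s ∈ Γ.vertices) ∧ x ∈ s ∧ y ∈ s) a b

/-- The isomorphism relation on trivalent graphs with a given set of half-edges. -/
instance isoSetoid (H : Type*) : Setoid (TrivalentGraph H) where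
  r Γ Δ := ∃ σ : H ≃ H, Γ.IsIso Δ σ
  iseqv :=
    { refl := fun Γ => ⟨_, IsIso.refl Γ⟩
      symm := fun ⟨_, h⟩ => ⟨_, h.symm⟩
      trans := fun ⟨_, h⟩ ⟨_, h'⟩ => ⟨_, h.trans h'⟩ }

instance [Finite H] : Finite (TrivalentGraph H) :=
  Finite.of_injective (fun Γ : TrivalentGraph H => (Γ.edges, Γ.vertices)) (by
    rintro ⟨e, v, _, _, _, _⟩ ⟨e', v', _, _, _, _⟩ h
    simp only [Prod.mk.injEq] at h
    obtain ⟨rfl, rfl⟩ := h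
    rfl)

/-- A trivalent graph has three times as many half-edges as vertices. -/
theorem card_halfEdges [Fintype H] (Γ : TrivalentGraph H) :
    Fintype.card H = 3 * Γ.vertices.card := by
  classical
  have hU : Γ.vertices.biUnion id = Finset.univ := by
    ext h
    obtain ⟨v, ⟨hv, hh⟩, -⟩ := Γ.existsUnique_vertex h
    simpa using ⟨v, hv, hh⟩
  have hd : (Γ.vertices : Set (Finset H)).PairwiseDisjoint id := by
    intro v hv w hw hvw
    refine Finset.disjoint_left.2 fun h h1 h2 => hvw ?_
    exact (Γ.existsUnique_vertex h).unique ⟨hv, h1⟩ ⟨hw, h2⟩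
  rw [← Finset.card_univ, ← hU, Finset.card_biUnion hd, mul_comm]
  exact Finset.sum_const_nat fun v hv => Γ.card_of_mem_vertices v hv

/-- The graph with half-edges renamed along a bijection. -/
def relabel (Γ : TrivalentGraph H) (σ : H ≃ K) : TrivalentGraph K where
  edges := Γ.edges.map (Finset.mapEmbedding σ.toEmbedding).toEmbedding
  vertices := Γ.vertices.map (Finset.mapEmbedding σ.toEmbedding).toEmbedding
  card_of_mem_edges := by
    intro e he
    obtain ⟨s, hs, rfl⟩ := Finset.mem_map.1 he
    simpa using Γ.card_of_mem_edges s hs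
  card_of_mem_vertices := by
    intro e he
    obtain ⟨s, hs, rfl⟩ := Finset.mem_map.1 he
    simpa using Γ.card_of_mem_vertices s hs
  existsUnique_edge := by
    intro h
    obtain ⟨e, ⟨he, hh⟩, hu⟩ := Γ.existsUnique_edge (σ.symm h)
    refine ⟨e.map σ.toEmbedding, ⟨Finset.mem_map.2 ⟨e, he, rfl⟩, by simpa using hh⟩, ?_⟩
    rintro f ⟨hf, hhf⟩
    obtain ⟨s, hs, rfl⟩ := Finset.mem_map.1 hf
    rw [← hu s ⟨hs, by simpa using hhf⟩]
    rfl
  existsUnique_vertex := by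
    intro h
    obtain ⟨e, ⟨he, hh⟩, hu⟩ := Γ.existsUnique_vertex (σ.symm h)
    refine ⟨e.map σ.toEmbedding, ⟨Finset.mem_map.2 ⟨e, he, rfl⟩, by simpa using hh⟩, ?_⟩
    rintro f ⟨hf, hhf⟩
    obtain ⟨s, hs, rfl⟩ := Finset.mem_map.1 hf
    rw [← hu s ⟨hs, by simpa using hhf⟩]
    rfl

theorem isIso_relabel (Γ : TrivalentGraph H) (σ : H ≃ K) : Γ.IsIso (Γ.relabel σ) σ := by
  constructor <;> intro s
  · exact (Finset.mem_map' (Finset.mapEmbedding σ.toEmbedding).toEmbedding).symm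
  · exact (Finset.mem_map' (Finset.mapEmbedding σ.toEmbedding).toEmbedding).symm

/-- Every trivalent graph with `2m` vertices is isomorphic to one whose set of half-edges is
`Fin (6 * m)`. -/
theorem exists_isIso_fin [Fintype H] (Γ : TrivalentGraph H) (m : ℕ)
    (h : Γ.vertices.card = 2 * m) :
    ∃ (Δ : TrivalentGraph (Fin (6 * m))) (σ : H ≃ Fin (6 * m)), Γ.IsIso Δ σ := by
  have hc : Fintype.card H = 6 * m := by rw [Γ.card_halfEdges, h]; ring
  exact ⟨_, _, Γ.isIso_relabel (Fintype.equivFinOfCardEq hc)⟩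

end TrivalentGraph

/-! ### Weights -/

/-- Evaluation of a tensor with `n` indices on an unordered collection of `n` indices. It is
meant for symmetric tensors, for which the order in which the indices are listed is irrelevant,
see `evalMultiset_map`. -/
def evalMultiset {N n : ℕ} (T : (Fin n → Fin N) → ℝ) (s : Multiset (Fin N)) : ℝ :=
  if h : s.toList.length = n then T (fun r => s.toList.get (r.cast h.symm)) else 0

theorem evalMultiset_map {N n : ℕ} (T : (Fin n → Fin N) → ℝ)
    (hT : ∀ (σ : Equiv.Perm (Fin n)) (t : Fin n → Fin N), T (fun r => t (σ r)) = T t)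
    (t : Fin n → Fin N) : evalMultiset T (Finset.univ.val.map t) = T t := by
  have hl : (Finset.univ.val.map t).toList.length = n := by simp
  rw [evalMultiset, dif_pos hl]
  have hp : (List.ofFn (fun r : Fin n => (Finset.univ.val.map t).toList.get (r.cast hl.symm))).Perm
      (List.ofFn t) := by
    rw [← Multiset.coe_eq_coe]
    have h1 : List.ofFn (fun r : Fin n => (Finset.univ.val.map t).toList.get (r.cast hl.symm))
        = (Finset.univ.val.map t).toList := by
      apply List.ext_get
      · simp
      · intro i h1 h2
        simp
    rw [h1, Multiset.coe_toList, List.ofFn_eq_map, ← Multiset.map_coe]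
    rfl
  set u : Fin n → Fin N := fun r => (Finset.univ.val.map t).toList.get (r.cast hl.symm)
  have hs : u ∘ Tuple.sort u = t ∘ Tuple.sort t :=
    List.ofFn_injective <|
      ((((Tuple.sort u).ofFn_comp_perm u).trans hp).trans
        ((Tuple.sort t).ofFn_comp_perm t).symm).eq_of_pairwise'
        (Tuple.monotone_sort u).sortedLE_ofFn.pairwise (Tuple.monotone_sort t).sortedLE_ofFn.pairwise
  rw [← hT (Tuple.sort u) u, ← hT (Tuple.sort t) t]
  exact congrArg T hs

/-- The components `V_{jkl} = V(e_j, e_k, e_l)` of a cubic form on `ℝ^N`. -/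
def cubicComponents {N : ℕ} (V : MultilinearMap ℝ (fun _ : Fin 3 => Fin N → ℝ) ℝ)
    (t : Fin 3 → Fin N) : ℝ :=
  V (fun r => Pi.single (t r) 1)

/-- The matrix `Q_{jk} = Q(e_j, e_k)` of a quadratic form on `ℝ^N`. -/
def quadraticMatrix {N : ℕ} (Q : LinearMap.BilinForm ℝ (Fin N → ℝ)) : Matrix (Fin N) (Fin N) ℝ :=
  Matrix.of fun j k => Q (Pi.single j 1) (Pi.single k 1)

/-- The components `Q^{jk}` of the inverse of `Q`. -/
def propagatorComponents {N : ℕ} (Q : LinearMap.BilinForm ℝ (Fin N → ℝ))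
    (t : Fin 2 → Fin N) : ℝ :=
  (quadraticMatrix Q)⁻¹ (t 0) (t 1)

/-- The weight `W(Γ)`: label the half-edges by indices, put `V` at the vertices and `Q⁻¹` on the
edges, each evaluated at the labels of its half-edges, and sum over all labelings. -/
def TrivalentGraph.weight {H : Type*} [Fintype H] [DecidableEq H] {N : ℕ}
    (Q : LinearMap.BilinForm ℝ (Fin N → ℝ))
    (V : MultilinearMap ℝ (fun _ : Fin 3 => Fin N → ℝ) ℝ) (Γ : TrivalentGraph H) : ℝ :=
  ∑ l : H → Fin N,
    (∏ v ∈ Γ.vertices, evalMultiset (cubicComponents V) (v.val.map l)) *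
      ∏ e ∈ Γ.edges, evalMultiset (propagatorComponents Q) (e.val.map l)

namespace TrivalentGraph

variable {H K : Type*}

theorem IsIso.weight_eq [Fintype H] [DecidableEq H] [Fintype K] [DecidableEq K] {N : ℕ}
    (Q : LinearMap.BilinForm ℝ (Fin N → ℝ))
    (V : MultilinearMap ℝ (fun _ : Fin 3 => Fin N → ℝ) ℝ)
    {Γ : TrivalentGraph H} {Δ : TrivalentGraph K} {σ : H ≃ K} (h : Γ.IsIso Δ σ) :
    Γ.weight Q V = Δ.weight Q V := by
  have hE : Δ.edges = Γ.edges.map (Finset.mapEmbedding σ.toEmbedding).toEmbedding := by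
    ext s
    rw [h.symm.1, Finset.mem_map]
    constructor
    · intro hs
      exact ⟨_, hs, by ext; simp⟩
    · rintro ⟨t, ht, rfl⟩
      convert ht
      ext; simp
  have hV : Δ.vertices = Γ.vertices.map (Finset.mapEmbedding σ.toEmbedding).toEmbedding := by
    ext s
    rw [h.symm.2, Finset.mem_map]
    constructor
    · intro hs
      exact ⟨_, hs, by ext; simp⟩
    · rintro ⟨t, ht, rfl⟩
      convert ht
      ext; simp
  unfold weight
  rw [hE, hV]
  refine Fintype.sum_equiv (Equiv.arrowCongr σ (Equiv.refl _)) _ _ fun l => ?_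
  simp [Finset.prod_map, Finset.map_val, Multiset.map_map, Function.comp_def]

theorem IsIso.card_aut_eq {Γ : TrivalentGraph H} {Δ : TrivalentGraph K} {σ : H ≃ K}
    (h : Γ.IsIso Δ σ) : Nat.card Γ.Aut = Nat.card Δ.Aut :=
  Nat.card_congr
    { toFun := fun a => ⟨(σ.symm.trans a.1).trans σ, (h.symm.trans a.2).trans h⟩
      invFun := fun a => ⟨(σ.trans a.1).trans σ.symm, (h.trans a.2).trans h.symm⟩
      left_inv := fun a => by ext x; simp
      right_inv := fun a => by ext x; simp }

theorem IsIso.connected {Γ : TrivalentGraph H} {Δ : TrivalentGraph K} {σ : H ≃ K}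
    (h : Γ.IsIso Δ σ) (hΓ : Γ.Connected) : Δ.Connected := by
  obtain ⟨⟨x⟩, hc⟩ := hΓ
  refine ⟨⟨σ x⟩, fun a b => ?_⟩
  have := Relation.ReflTransGen.lift (r := fun x y => ∃ s : Finset H,
    (s ∈ Γ.edges ∨ s ∈ Γ.vertices) ∧ x ∈ s ∧ y ∈ s) (p := fun x y => ∃ s : Finset K,
    (s ∈ Δ.edges ∨ s ∈ Δ.vertices) ∧ x ∈ s ∧ y ∈ s) σ ?_ _ _ (hc (σ.symm a) (σ.symm b))
  · simpa [Function.onFun] using this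
  · rintro p q ⟨s, hs, hp, hq⟩
    exact ⟨s.map σ.toEmbedding, hs.imp (h.1 s).1 (h.2 s).1, by simpa using hp, by simpa using hq⟩

end TrivalentGraph

/-- The isomorphism classes of trivalent graphs with `2m` vertices (and hence `6m` half-edges). -/
def GraphClass (m : ℕ) : Type :=
  Quotient (TrivalentGraph.isoSetoid (Fin (6 * m)))

namespace GraphClass

instance (m : ℕ) : Finite (GraphClass m) :=
  inferInstanceAs (Finite (Quotient (TrivalentGraph.isoSetoid (Fin (6 * m)))))

instance (m : ℕ) : Fintype (GraphClass m) := Fintype.ofFinite _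

/-- The weight `W(Γ)` of an isomorphism class. -/
def weight {m N : ℕ} (Q : LinearMap.BilinForm ℝ (Fin N → ℝ))
    (V : MultilinearMap ℝ (fun _ : Fin 3 => Fin N → ℝ) ℝ) (γ : GraphClass m) : ℝ :=
  Quotient.lift (TrivalentGraph.weight Q V) (by rintro _ _ ⟨_, h⟩; exact h.weight_eq Q V) γ

/-- The order `|Aut Γ|` of the automorphism group for an isomorphism class. -/
def autCard {m : ℕ} (γ : GraphClass m) : ℕ :=
  Quotient.lift (fun Γ : TrivalentGraph (Fin (6 * m)) => Nat.card Γ.Aut)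
    (by rintro _ _ ⟨_, h⟩; exact h.card_aut_eq) γ

/-- Connectedness of an isomorphism class. -/
def Connected {m : ℕ} (γ : GraphClass m) : Prop :=
  Quotient.lift (fun Γ : TrivalentGraph (Fin (6 * m)) => Γ.Connected)
    (by rintro _ _ ⟨_, h⟩; exact propext ⟨h.connected, h.symm.connected⟩) γ

end GraphClass

/-- The sum of `W(Γ) / |Aut Γ|` over all trivalent graphs with `2m` vertices, up to
isomorphism. -/
def graphSum {N : ℕ} (Q : LinearMap.BilinForm ℝ (Fin N → ℝ))
    (V : MultilinearMap ℝ (fun _ : Fin 3 => Fin N → ℝ) ℝ) (m : ℕ) : ℝ :=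
  ∑ γ : GraphClass m, γ.weight Q V / γ.autCard

open Classical in
/-- The sum of `W(Γ) / |Aut Γ|` over all connected trivalent graphs with `2m` vertices, up to
isomorphism. -/
def connectedGraphSum {N : ℕ} (Q : LinearMap.BilinForm ℝ (Fin N → ℝ))
    (V : MultilinearMap ℝ (fun _ : Fin 3 => Fin N → ℝ) ℝ) (m : ℕ) : ℝ :=
  ∑ γ : GraphClass m with γ.Connected, γ.weight Q V / γ.autCard

/-! ### Formal integrals -/

/-- `z` is the value of the oscillatory integral `∫_{ℝ^N} e^{(i/2) Q(x,x)} P(x) dx`, defined by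
analytic continuation: for `ε > 0` the integral with `Q` replaced by the complex quadratic form
`Q + iε|x|²`, with positive definite imaginary part, converges absolutely, and `z` is the boundary
value as `ε → 0+`. -/
def HasOscillatoryIntegral {N : ℕ} (Q : LinearMap.BilinForm ℝ (Fin N → ℝ))
    (P : (Fin N → ℝ) → ℂ) (z : ℂ) : Prop :=
  (∀ ε : ℝ, 0 < ε → Integrable fun x : Fin N → ℝ =>
    Complex.exp (Complex.I / 2 * (Q x x + Complex.I * ε * ∑ j, (x j : ℂ) ^ 2)) * P x) ∧
  Tendsto (fun ε : ℝ => ∫ x : Fin N → ℝ,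
    Complex.exp (Complex.I / 2 * (Q x x + Complex.I * ε * ∑ j, (x j : ℂ) ^ 2)) * P x)
    (𝓝[>] 0) (𝓝 z)

theorem HasOscillatoryIntegral.unique {N : ℕ} {Q : LinearMap.BilinForm ℝ (Fin N → ℝ)}
    {P : (Fin N → ℝ) → ℂ} {z w : ℂ} (hz : HasOscillatoryIntegral Q P z)
    (hw : HasOscillatoryIntegral Q P w) : z = w :=
  tendsto_nhds_unique hz.2 hw.2

/-- The `j`-th term `(ik V(x,x,x) / 6)^j / j!` of the power series of `e^{(ik/6) V(x,x,x)}`. -/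
def cubicTerm {N : ℕ} (V : MultilinearMap ℝ (fun _ : Fin 3 => Fin N → ℝ) ℝ) (k : ℝ) (j : ℕ)
    (x : Fin N → ℝ) : ℂ :=
  (Complex.I * k * (V fun _ => x) / 6) ^ j / j.factorial

/-- A formal series `k^a ∑_j c_j k^{-j/2}` with `a = exponent` and `c_j = series.coeff j`; thus
`series` is a power series in `k^{-1/2}`. -/
@[ext]
structure FormalSeries where
  exponent : ℝ
  series : ℂ⟦X⟧

/-- A formal expression `a log k + ∑_j c_j k^{-j/2}` with `a = logCoeff`,
`c_j = series.coeff j`. -/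
@[ext]
structure FormalLogSeries where
  logCoeff : ℝ
  series : ℂ⟦X⟧

/-- Multiplication of a formal series by a constant. -/
def FormalSeries.const_mul (c : ℂ) (Z : FormalSeries) : FormalSeries :=
  ⟨Z.exponent, PowerSeries.C c * Z.series⟩

/-- The formal logarithm `log (k^a S(k^{-1/2})) = a log k + (log S)(k^{-1/2})` of a formal series
for which `S` has constant coefficient `1`. -/
def FormalSeries.log (Z : FormalSeries) : FormalLogSeries :=
  ⟨Z.exponent, PowerSeries.logOf Z.series⟩

/-- `Z` is the formal integral `Z_k = ∫_{ℝ^N} e^{ik (Q(x,x)/2 + V(x,x,x)/6)} dx`: expanding the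
exponential of the cubic term into its power series and integrating term by term, the `j`-th
integral is the `j`-th term of the formal series `Z`, for every `k > 0`. -/
def IsFormalIntegral {N : ℕ} (Q : LinearMap.BilinForm ℝ (Fin N → ℝ))
    (V : MultilinearMap ℝ (fun _ : Fin 3 => Fin N → ℝ) ℝ) (Z : FormalSeries) : Prop :=
  ∀ k : ℝ, 0 < k → ∀ j : ℕ,
    HasOscillatoryIntegral (k • Q) (cubicTerm V k j)
      (Z.series.coeff j * ((k ^ (Z.exponent - j / 2) : ℝ) : ℂ))

end FeynmanModel

end

open FeynmanModel

/-! Everything rests on one linear functional `L` on polynomials, the oscillatory Gaussian moment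
(`exists_oscillatory_functional`). For ε > 0 the Gaussian decays, so integration by parts has no
boundary terms and gives E[∂_j p] = ∑_k M_{jk} E[x_k p] with M = ε - iA, where A is the matrix of Q.
Inverting M expresses E[x_k p] through derivatives of p. By induction on the degree every moment has
a limit as ε → 0+ once E[1] has one, and in the limit M⁻¹ becomes i A⁻¹. The base case E[1] is a
product of one-dimensional Gaussian integrals in eigencoordinates of A, with nonzero limit because
no eigenvalue vanishes.

The resulting recursion L(x_k p) = ∑_j i Q^{kj} L(∂_j p) is all that Wick's theorem needs: `wick`
turns L of a product of coordinates into L(1) times a sum over pairings. Expanding V^{2m} over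
labelings of 2m × 3 half-edges, pairings are the trivalent graphs whose vertices are the fixed
triples. The j = 2m term thus carries i^{2m} from the exponential and i^{3m} from the 3m edges, in
total i^{5m} = i^m. Rescaling x by √k produces the powers of k.

Passing from graphs with fixed vertices to isomorphism classes is orbit-stabilizer. The permutations
preserving the vertex partition form a group of order (2m)! 6^{2m}, the orbit of Γ consists of the
gluings isomorphic to Γ, and its stabilizer is Aut Γ. The count cancels the denominator (2m)! 6^{2m}
of the expansion.

For the logarithm, a half-edge is marked in a graph on n labelled half-edges and its component is
split off. With total weights T_n and connected total weights C_n this gives n T_n = ∑_k (n choose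
k) k C_k T_{n-k}. As T_{6m} = (6m)! a_m and C_{6m} = (6m)! c_m, where a_m and c_m are the sums over
classes, it becomes m a_m = ∑_k k c_k a_{m-k} (`mul_graphSum`). This is the coefficient form of F' =
G' F, which together with the constant terms forces log F = G. -/

namespace FeynmanModel

/-! ### Gaussian integrals with polynomial factors -/

section Gaussian

variable {N : ℕ} (Q : LinearMap.BilinForm ℝ (Fin N → ℝ))

/-- The regularised oscillating Gaussian `e^{(i/2)(Q(x,x) + iε|x|²)}`. -/
noncomputable def regGaussian (ε : ℝ) (x : Fin N → ℝ) : ℂ :=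
  Complex.exp (Complex.I / 2 * (Q x x + Complex.I * ε * ∑ j, (x j : ℂ) ^ 2))

/-- A complex polynomial as a function on `ℝ^N`. -/
noncomputable def polyFun (p : MvPolynomial (Fin N) ℂ) (x : Fin N → ℝ) : ℂ :=
  MvPolynomial.eval (fun j => (x j : ℂ)) p

theorem bilinForm_apply_eq_sum (x y : Fin N → ℝ) :
    Q x y = ∑ j, ∑ k, x j * quadraticMatrix Q j k * y k := by
  conv_lhs => rw [← Finset.univ_sum_single x, ← Finset.univ_sum_single y]
  simp only [map_sum, LinearMap.sum_apply]
  rw [Finset.sum_comm]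
  refine Finset.sum_congr rfl fun j _ => Finset.sum_congr rfl fun k _ => ?_
  have hx : (Pi.single j (x j) : Fin N → ℝ) = x j • Pi.single j 1 := by
    rw [← Pi.single_smul, smul_eq_mul, mul_one]
  have hy : (Pi.single k (y k) : Fin N → ℝ) = y k • Pi.single k 1 := by
    rw [← Pi.single_smul, smul_eq_mul, mul_one]
  rw [hx, hy]
  simp only [map_smul, LinearMap.smul_apply, smul_eq_mul, quadraticMatrix, Matrix.of_apply]
  ring

theorem quadraticMatrix_det_ne_zero (hQ : Q.Nondegenerate) : (quadraticMatrix Q).det ≠ 0 := by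
  have h : quadraticMatrix Q = LinearMap.BilinForm.toMatrix' Q := by
    ext j k
    exact (LinearMap.toMatrix₂'_apply Q j k).symm
  rw [h]
  exact Matrix.nondegenerate_iff_det_ne_zero.1
    (LinearMap.BilinForm.nondegenerate_toMatrix'_iff.2 hQ)

theorem continuous_bilinForm_diag : Continuous fun x : Fin N → ℝ => Q x x := by
  simp_rw [bilinForm_apply_eq_sum Q]
  fun_prop

theorem continuous_regGaussian (ε : ℝ) : Continuous (regGaussian Q ε) := by
  have := continuous_bilinForm_diag Q
  unfold regGaussian
  fun_prop

/-- Since Q is real it only contributes a phase; the decay comes from ε alone and factors over the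
coordinates. -/
theorem norm_regGaussian (ε : ℝ) (x : Fin N → ℝ) :
    ‖regGaussian Q ε x‖ = ∏ j, Real.exp (-(ε / 2) * x j ^ 2) := by
  have h : (Complex.I / 2 * (Q x x + Complex.I * ε * ∑ j, (x j : ℂ) ^ 2)) =
      ((∑ j, -(ε / 2) * x j ^ 2 : ℝ) : ℂ) + ((Q x x / 2 : ℝ) : ℂ) * Complex.I := by
    push_cast
    rw [← Finset.mul_sum]
    linear_combination (ε / 2 * ∑ j, (x j : ℂ) ^ 2) * Complex.I_sq
  rw [regGaussian, h, Complex.norm_exp, Complex.add_re, Complex.ofReal_re, Complex.re_ofReal_mul,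
    Complex.I_re, mul_zero, add_zero, Real.exp_sum]

theorem integrable_pow_mul_gaussian {b : ℝ} (hb : 0 < b) (n : ℕ) :
    Integrable fun x : ℝ => |x| ^ n * Real.exp (-b * x ^ 2) := by
  have h := (integrable_rpow_mul_exp_neg_mul_sq hb (s := n)
    (by linarith [(Nat.cast_nonneg n : (0 : ℝ) ≤ n)])).norm
  refine h.congr (Eventually.of_forall fun x => ?_)
  simp [Real.rpow_natCast]

/-- Each monomial is dominated by a product of one-variable functions |t|^d e^{-εt²/2}, so
integrability reduces to dimension one. -/
theorem integrable_regGaussian_mul_polyFun {ε : ℝ} (hε : 0 < ε) (p : MvPolynomial (Fin N) ℂ) :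
    Integrable fun x => regGaussian Q ε x * polyFun p x := by
  simp only [polyFun, MvPolynomial.eval_eq', Finset.mul_sum]
  refine integrable_finsetSum _ fun d _ => ?_
  have hi : Integrable fun x : Fin N → ℝ =>
      ∏ j, (|x j| ^ d j * Real.exp (-(ε / 2) * x j ^ 2)) :=
    Integrable.fintype_prod (f := fun j (t : ℝ) => |t| ^ d j * Real.exp (-(ε / 2) * t ^ 2))
      fun j => integrable_pow_mul_gaussian (half_pos hε) (d j)
  have hc := continuous_regGaussian Q ε
  refine (hi.const_mul ‖p.coeff d‖).mono' ?_ (Eventually.of_forall fun x => ?_)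
  · exact (by fun_prop : Continuous _).aestronglyMeasurable
  · rw [norm_mul, norm_mul, norm_regGaussian, norm_prod, Finset.prod_mul_distrib]
    simp only [norm_pow, Complex.norm_real, Real.norm_eq_abs]
    exact le_of_eq (by ring)

/-! Integration by parts. -/

theorem hasLineDerivAt_polyFun (p : MvPolynomial (Fin N) ℂ) (x : Fin N → ℝ) (j : Fin N) :
    HasLineDerivAt ℝ (polyFun p) (polyFun (MvPolynomial.pderiv j p) x) x (Pi.single j 1) := by
  induction p using MvPolynomial.induction_on with
  | C a =>
    simp only [polyFun, MvPolynomial.eval_C, MvPolynomial.pderiv_C, map_zero, HasLineDerivAt]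
    exact hasDerivAt_const _ _
  | add p q hp hq =>
    simp only [HasLineDerivAt, polyFun, map_add] at *
    exact hp.add hq
  | mul_X p k hp =>
    have hX : HasDerivAt (fun t : ℝ => (((x + t • (Pi.single j 1 : Fin N → ℝ)) k : ℝ) : ℂ))
        ((Pi.single j (1 : ℝ) : Fin N → ℝ) k : ℝ) 0 := by
      simp only [Pi.add_apply, Pi.smul_apply, smul_eq_mul]
      exact (((hasDerivAt_id (0 : ℝ)).mul_const _).const_add _
        |>.congr_deriv (one_mul _)).ofReal_comp
    simp only [HasLineDerivAt, polyFun] at *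
    have := hp.mul hX
    simp only [map_mul, MvPolynomial.eval_X, Derivation.leibniz, MvPolynomial.pderiv_X, map_add,
      smul_eq_mul]
    refine this.congr_deriv ?_
    by_cases h : k = j
    · subst h; simp; ring
    · simp [h]; ring

/-- The logarithmic derivative of a Gaussian is linear: here it is the j-th entry of -(ε - iA)x.
Symmetry of Q merges the two cross terms. -/
theorem hasLineDerivAt_regGaussian (hQs : ∀ x y, Q x y = Q y x) (ε : ℝ) (x : Fin N → ℝ)
    (j : Fin N) :
    HasLineDerivAt ℝ (regGaussian Q ε)
      (-(ε * x j - Complex.I * ∑ k, quadraticMatrix Q j k * (x k : ℂ)) * regGaussian Q ε x) x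
      (Pi.single j 1) := by
  unfold HasLineDerivAt regGaussian
  set e : Fin N → ℝ := Pi.single j 1 with he
  have hQe : ∀ t : ℝ, Q (x + t • e) (x + t • e) = Q x x + t * (2 * Q e x) + t ^ 2 * Q e e := by
    intro t
    simp only [map_add, map_smul, LinearMap.add_apply, LinearMap.smul_apply, smul_eq_mul,
      hQs x e]
    ring
  have hex : Q e x = ∑ k, quadraticMatrix Q j k * x k := by
    rw [bilinForm_apply_eq_sum, Finset.sum_eq_single j]
    · simp [he]
    · intro i _ hi; simp [he, hi]
    · simp
  have hs : ∀ t : ℝ, ∑ k, (x + t • e) k ^ 2 = ∑ k, x k ^ 2 + t * (2 * x j) + t ^ 2 := by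
    intro t
    have : ∀ k, (x + t • e) k ^ 2 = x k ^ 2 + t * (2 * x k * e k) + t ^ 2 * e k := by
      intro k
      by_cases h : k = j
      · subst h; simp [he]; ring
      · simp [he, h]
    simp only [this, Finset.sum_add_distrib, ← Finset.mul_sum]
    simp [he, Pi.single_apply]
  have h1 : HasDerivAt (fun t : ℝ => Q (x + t • e) (x + t • e)) (2 * Q e x) 0 := by
    simp only [hQe]
    have := (((hasDerivAt_id (0 : ℝ)).mul_const (2 * Q e x)).const_add (Q x x)).add
      (((hasDerivAt_id (0 : ℝ)).pow 2).mul_const (Q e e))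
    exact this.congr_deriv (by simp)
  have h2 : HasDerivAt (fun t : ℝ => ∑ k, (x + t • e) k ^ 2) (2 * x j) 0 := by
    simp only [hs]
    have := (((hasDerivAt_id (0 : ℝ)).mul_const (2 * x j)).const_add (∑ k, x k ^ 2)).add
      ((hasDerivAt_id (0 : ℝ)).pow 2)
    exact this.congr_deriv (by simp)
  have h3 := ((h1.ofReal_comp.add (h2.ofReal_comp.const_mul (Complex.I * ε))).const_mul
    (Complex.I / 2)).cexp
  have hfun : (fun t : ℝ => Complex.exp (Complex.I / 2 * (((Q (x + t • e) (x + t • e) : ℝ) : ℂ) +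
      Complex.I * ε * ∑ k, ((((x + t • e) k : ℝ) : ℂ)) ^ 2))) = fun t : ℝ =>
      Complex.exp (Complex.I / 2 * (((Q (x + t • e) (x + t • e) : ℝ) : ℂ) +
      Complex.I * ε * ((∑ k, (x + t • e) k ^ 2 : ℝ) : ℂ))) := by
    push_cast; rfl
  rw [hfun]
  refine h3.congr_deriv ?_
  simp only [zero_smul, add_zero, hex, Pi.add_apply, Pi.zero_apply]
  push_cast
  linear_combination (Complex.exp (Complex.I / 2 * (Q x x + Complex.I * ε * ∑ j, (x j : ℂ) ^ 2)) *
    ε * x j) * Complex.I_sq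

/-- The regularised moment of a polynomial. -/
noncomputable def regMoment (ε : ℝ) (p : MvPolynomial (Fin N) ℂ) : ℂ :=
  ∫ x, regGaussian Q ε x * polyFun p x

theorem regMoment_add {ε : ℝ} (hε : 0 < ε) (p q : MvPolynomial (Fin N) ℂ) :
    regMoment Q ε (p + q) = regMoment Q ε p + regMoment Q ε q := by
  simp only [regMoment, polyFun, map_add, mul_add]
  exact integral_add (integrable_regGaussian_mul_polyFun Q hε p)
    (integrable_regGaussian_mul_polyFun Q hε q)

theorem regMoment_C_mul (ε : ℝ) (a : ℂ) (p : MvPolynomial (Fin N) ℂ) :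
    regMoment Q ε (MvPolynomial.C a * p) = a * regMoment Q ε p := by
  simp only [regMoment, polyFun, map_mul, MvPolynomial.eval_C, mul_left_comm _ a]
  exact integral_const_mul _ _

theorem regMoment_sum {ι : Type*} {ε : ℝ} (hε : 0 < ε) (s : Finset ι)
    (p : ι → MvPolynomial (Fin N) ℂ) :
    regMoment Q ε (∑ i ∈ s, p i) = ∑ i ∈ s, regMoment Q ε (p i) := by
  simp only [regMoment, polyFun, map_sum, Finset.mul_sum]
  exact integral_finsetSum _ fun i _ => integrable_regGaussian_mul_polyFun Q hε (p i)

/-- Integration by parts: the derivative moves to the Gaussian, which returns the linear factor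
(Mx)_j with M = ε - iA. -/
theorem regMoment_pderiv (hQs : ∀ x y, Q x y = Q y x) {ε : ℝ} (hε : 0 < ε)
    (p : MvPolynomial (Fin N) ℂ) (j : Fin N) :
    regMoment Q ε (MvPolynomial.pderiv j p) =
      ∑ k, ((ε : ℂ) • (1 : Matrix (Fin N) (Fin N) ℂ) -
        Complex.I • (quadraticMatrix Q).map Complex.ofReal) j k *
          regMoment Q ε (MvPolynomial.X k * p) := by
  set M := ((ε : ℂ) • (1 : Matrix (Fin N) (Fin N) ℂ) -
        Complex.I • (quadraticMatrix Q).map Complex.ofReal) with hM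
  have hMx : ∀ x : Fin N → ℝ, (ε * x j - Complex.I * ∑ k, quadraticMatrix Q j k * (x k : ℂ)) =
      ∑ k, M j k * x k := by
    intro x
    simp only [hM, Matrix.sub_apply, Matrix.smul_apply, Matrix.one_apply, Matrix.map_apply,
      smul_eq_mul, sub_mul, Finset.sum_sub_distrib, Finset.mul_sum]
    simp [mul_assoc]
  have hq : ∀ x : Fin N → ℝ, polyFun (∑ k, MvPolynomial.C (M j k) * (MvPolynomial.X k * p)) x =
      (∑ k, M j k * x k) * polyFun p x := by
    intro x
    simp [polyFun, Finset.sum_mul, mul_assoc]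
  have key : ∫ x, regGaussian Q ε x * polyFun (MvPolynomial.pderiv j p) x =
      -∫ x, (-(∑ k, M j k * x k) * regGaussian Q ε x) * polyFun p x := by
    refine integral_bilinear_hasLineDerivAt_right_eq_neg_left_of_integrable
      (B := ContinuousLinearMap.mul ℝ ℂ) (v := Pi.single j 1) ?_ ?_ ?_
      (fun x _ => ?_) (fun x _ => hasLineDerivAt_polyFun p x j)
    · refine (integrable_regGaussian_mul_polyFun Q hε
        (∑ k, MvPolynomial.C (M j k) * (MvPolynomial.X k * p))).neg.congr
          (Eventually.of_forall fun x => ?_)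
      simp only [Pi.neg_apply, hq, ContinuousLinearMap.mul_apply']
      ring
    · exact integrable_regGaussian_mul_polyFun Q hε _
    · exact integrable_regGaussian_mul_polyFun Q hε _
    · rw [← hMx]
      exact hasLineDerivAt_regGaussian Q hQs ε x j
  have hsum : regMoment Q ε (∑ k, MvPolynomial.C (M j k) * (MvPolynomial.X k * p)) =
      ∑ k, M j k * regMoment Q ε (MvPolynomial.X k * p) := by
    rw [regMoment_sum Q hε]
    exact Finset.sum_congr rfl fun k _ => regMoment_C_mul Q ε _ _
  rw [← hsum, regMoment, key, ← integral_neg, regMoment]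
  refine integral_congr_ae (Eventually.of_forall fun x => ?_)
  simp only [hq]
  ring

end Gaussian

/-! ### Boundary values of the moments as ε → 0+ -/

section GaussianLimit

variable {N : ℕ} (Q : LinearMap.BilinForm ℝ (Fin N → ℝ))

/-- A symmetric form is diagonalised by a linear map that preserves Lebesgue measure and the
Euclidean norm. -/
theorem exists_diagonalization (hQs : ∀ x y, Q x y = Q y x) (hQ : Q.Nondegenerate) :
    ∃ (d : Fin N → ℝ) (U : (Fin N → ℝ) →ₗ[ℝ] (Fin N → ℝ)), (∀ a, d a ≠ 0) ∧
      MeasurePreserving U ∧ MeasurableEmbedding U ∧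
      (∀ y, Q (U y) (U y) = ∑ a, d a * y a ^ 2) ∧ ∀ y, ∑ j, U y j ^ 2 = ∑ a, y a ^ 2 := by
  set A := quadraticMatrix Q with hA
  have hH : A.IsHermitian := by
    ext j k
    simp [hA, quadraticMatrix, hQs (Pi.single k 1)]
  set U : Matrix (Fin N) (Fin N) ℝ := hH.eigenvectorUnitary.1 with hU
  have hUU : U.transpose * U = 1 := by
    have := Unitary.coe_star_mul_self hH.eigenvectorUnitary
    rwa [Matrix.star_eq_conjTranspose, Matrix.conjTranspose_eq_transpose_of_trivial] at this
  have hdet : |U.det| = 1 := by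
    have := congrArg Matrix.det hUU
    rw [Matrix.det_mul, Matrix.det_transpose, Matrix.det_one] at this
    rw [← abs_one, ← sq_eq_sq_iff_abs_eq_abs, one_pow, sq, this]
  have hdet0 : U.det ≠ 0 := fun h => by simp [h] at hdet
  have hspec : U.transpose * A * U = Matrix.diagonal hH.eigenvalues := by
    have h1 := hH.spectral_theorem
    rw [Unitary.conjStarAlgAut_apply] at h1
    have h2 : A = U * Matrix.diagonal hH.eigenvalues * U.transpose := by
      simpa [Matrix.star_eq_conjTranspose, Function.comp_def, hU] using h1
    calc U.transpose * A * U = (U.transpose * U) * Matrix.diagonal hH.eigenvalues *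
        (U.transpose * U) := by
          conv_lhs => rw [h2]
          simp only [Matrix.mul_assoc]
      _ = _ := by rw [hUU, one_mul, mul_one]
  have hQA : ∀ x, Q x x = x ⬝ᵥ A.mulVec x := by
    intro x
    rw [bilinForm_apply_eq_sum]
    simp only [dotProduct, Matrix.mulVec, Finset.mul_sum, mul_assoc, hA]
  refine ⟨hH.eigenvalues, Matrix.toLin' U, fun a ha => ?_, ⟨?_, ?_⟩, ?_, fun y => ?_, fun y => ?_⟩
  -- A vanishing eigenvalue would make the determinant, which is their product, vanish.
  · refine quadraticMatrix_det_ne_zero Q hQ ?_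
    rw [hH.det_eq_prod_eigenvalues]
    exact Finset.prod_eq_zero (Finset.mem_univ a) (by simpa using ha)
  · exact (LinearMap.continuous_of_finiteDimensional _).measurable
  · rw [Real.map_matrix_volume_pi_eq_smul_volume_pi hdet0, abs_inv, hdet]
    simp
  · have hinj : Function.Injective (Matrix.toLin' U) := by
      intro x y hxy
      have := congrArg (Matrix.toLin' U.transpose) hxy
      simpa [Matrix.toLin'_apply, Matrix.mulVec_mulVec, hUU] using this
    exact ((LinearMap.continuous_of_finiteDimensional _).measurableEmbedding hinj)
  · rw [hQA, Matrix.toLin'_apply, Matrix.mulVec_mulVec, dotProduct_comm,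
      ← Matrix.dotProduct_transpose_mulVec, Matrix.mulVec_mulVec, ← Matrix.mul_assoc, hspec]
    simp only [dotProduct, Matrix.mulVec_diagonal]
    exact Finset.sum_congr rfl fun a _ => by ring
  · have : ∀ z : Fin N → ℝ, ∑ j, z j ^ 2 = z ⬝ᵥ z := fun z => by simp [dotProduct, sq]
    rw [this, this, Matrix.toLin'_apply, ← Matrix.dotProduct_transpose_mulVec,
      Matrix.mulVec_mulVec, hUU, Matrix.one_mulVec]

/-- In eigencoordinates the integral is a product of square roots, each continuous up to ε = 0
because its argument stays away from the branch cut. -/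
theorem exists_tendsto_regMoment_one (hQs : ∀ x y, Q x y = Q y x) (hQ : Q.Nondegenerate) :
    ∃ z : ℂ, z ≠ 0 ∧ Tendsto (fun ε => regMoment Q ε 1) (𝓝[>] 0) (𝓝 z) := by
  obtain ⟨d, U, hd, hU, hUe, hUQ, hUn⟩ := exists_diagonalization Q hQs hQ
  -- Chosen so that (i/2)(d_a + iε)y² = -b y², the standard complex Gaussian exponent, with Re b =
  -- ε/2.
  set b : ℝ → Fin N → ℂ := fun ε a => (ε - Complex.I * d a) / 2 with hb
  have hb0 : ∀ a, b 0 a ≠ 0 := by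
    intro a
    simp [hb, hd a]
  have hval : ∀ ε : ℝ, 0 < ε → regMoment Q ε 1 = ∏ a, (Real.pi / b ε a) ^ (1 / 2 : ℂ) := by
    intro ε hε
    have h1 := GaussianFourier.integral_cexp_neg_sum_mul_add (b := b ε)
      (fun a => by simpa [hb] using hε) (fun _ => 0)
    simp only [zero_mul, Finset.sum_const_zero, add_zero, ne_eq, OfNat.ofNat_ne_zero,
      not_false_eq_true, zero_pow, zero_div, Complex.exp_zero, mul_one] at h1
    rw [← h1, regMoment, ← hU.integral_comp hUe]
    refine integral_congr_ae (Eventually.of_forall fun y => ?_)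
    have h2 : ∑ j, ((U y j : ℝ) : ℂ) ^ 2 = ∑ a, (y a : ℂ) ^ 2 := by
      exact_mod_cast congrArg Complex.ofReal (hUn y)
    simp only [regGaussian, polyFun, map_one, mul_one, hUQ, h2, hb]
    congr 1
    push_cast
    rw [Finset.mul_sum, ← Finset.sum_add_distrib, Finset.mul_sum, ← Finset.sum_neg_distrib]
    refine Finset.sum_congr rfl fun a _ => ?_
    linear_combination (ε * (y a : ℂ) ^ 2 / 2) * Complex.I_sq
  refine ⟨∏ a, (Real.pi / b 0 a) ^ (1 / 2 : ℂ), ?_, ?_⟩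
  · refine Finset.prod_ne_zero_iff.2 fun a _ => ?_
    rw [Complex.cpow_ne_zero_iff_of_exponent_ne_zero (by norm_num)]
    exact div_ne_zero (by exact_mod_cast Real.pi_ne_zero) (hb0 a)
  · have hlim : Tendsto (fun ε => ∏ a, (Real.pi / b ε a) ^ (1 / 2 : ℂ)) (𝓝[>] 0)
        (𝓝 (∏ a, (Real.pi / b 0 a) ^ (1 / 2 : ℂ))) := by
      refine tendsto_finsetProd _ fun a _ => Tendsto.mono_left ?_ nhdsWithin_le_nhds
      have hc : ContinuousAt (fun ε => (Real.pi / b ε a) ^ (1 / 2 : ℂ)) 0 := by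
        refine ContinuousAt.cpow ?_ continuousAt_const ?_
        · refine ContinuousAt.div continuousAt_const ?_ (hb0 a)
          exact Continuous.continuousAt (by simp only [hb]; fun_prop)
        -- At ε = 0 the base is 2πi/d_a: a nonzero imaginary part puts it in the slit plane, where
        -- the principal power is continuous.
        · right
          have : (Real.pi : ℂ) / b 0 a = ((2 * Real.pi / d a : ℝ) : ℂ) * Complex.I := by
            have : (d a : ℂ) ≠ 0 := by exact_mod_cast hd a
            rw [div_eq_iff (hb0 a)]
            simp only [hb]
            push_cast
            field_simp
            linear_combination (d a : ℂ) * Complex.I_sq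
          rw [this, Complex.im_ofReal_mul, Complex.I_im, mul_one]
          exact div_ne_zero (by positivity) (hd a)
      exact hc
    refine hlim.congr' ?_
    filter_upwards [self_mem_nhdsWithin] with ε hε
    exact (hval ε hε).symm

/-- The inverse of `ε - iA` tends to `iA⁻¹`. -/
theorem tendsto_inv_regMatrix (hQ : Q.Nondegenerate) :
    (∀ᶠ ε : ℝ in 𝓝[>] 0, ((ε : ℂ) • (1 : Matrix (Fin N) (Fin N) ℂ) -
        Complex.I • (quadraticMatrix Q).map Complex.ofReal).det ≠ 0) ∧
    Tendsto (fun ε : ℝ => ((ε : ℂ) • (1 : Matrix (Fin N) (Fin N) ℂ) -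
        Complex.I • (quadraticMatrix Q).map Complex.ofReal)⁻¹) (𝓝[>] 0)
      (𝓝 (Complex.I • (quadraticMatrix Q)⁻¹.map Complex.ofReal)) := by
  set M : ℝ → Matrix (Fin N) (Fin N) ℂ := fun ε => ((ε : ℂ) • (1 : Matrix (Fin N) (Fin N) ℂ) -
        Complex.I • (quadraticMatrix Q).map Complex.ofReal) with hM
  have hdet := quadraticMatrix_det_ne_zero Q hQ
  have hMc : Continuous M := by simp only [hM]; fun_prop
  have hmul : (Complex.I • (quadraticMatrix Q)⁻¹.map Complex.ofReal) * M 0 = 1 := by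
    simp only [hM, Complex.ofReal_zero, zero_smul, zero_sub, mul_neg, Matrix.smul_mul,
      Matrix.mul_smul, smul_smul, Complex.I_mul_I, neg_smul, one_smul, neg_neg]
    have : ((quadraticMatrix Q)⁻¹ * quadraticMatrix Q).map Complex.ofReal =
        (1 : Matrix (Fin N) (Fin N) ℝ).map Complex.ofReal := by
      rw [Matrix.nonsing_inv_mul _ (isUnit_iff_ne_zero.2 hdet)]
    rw [Matrix.map_one _ Complex.ofReal_zero Complex.ofReal_one] at this
    rw [← this]
    exact (Matrix.map_mul (f := Complex.ofRealHom)).symm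
  have h0 : (M 0).det ≠ 0 := by
    intro h
    have := congrArg Matrix.det hmul
    simp [Matrix.det_mul, h] at this
  have hev : ∀ᶠ ε : ℝ in 𝓝 0, (M ε).det ≠ 0 := (hMc.matrix_det.continuousAt).eventually_ne h0
  refine ⟨hev.filter_mono nhdsWithin_le_nhds, ?_⟩
  rw [← Matrix.inv_eq_left_inv hmul]
  -- The inverse is the adjugate divided by the determinant, both continuous in ε, and the
  -- determinant is nonzero at 0.
  refine Tendsto.mono_left (f := fun ε => (M ε)⁻¹) ?_ nhdsWithin_le_nhds
  simp only [Matrix.inv_def, Ring.inverse_eq_inv']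
  exact (hMc.matrix_det.continuousAt.inv₀ h0).smul hMc.matrix_adjugate.continuousAt

theorem regMoment_X_mul (hQs : ∀ x y, Q x y = Q y x) {ε : ℝ} (hε : 0 < ε)
    (hdet : ((ε : ℂ) • (1 : Matrix (Fin N) (Fin N) ℂ) -
        Complex.I • (quadraticMatrix Q).map Complex.ofReal).det ≠ 0)
    (p : MvPolynomial (Fin N) ℂ) (k : Fin N) :
    regMoment Q ε (MvPolynomial.X k * p) =
      ∑ j, ((ε : ℂ) • (1 : Matrix (Fin N) (Fin N) ℂ) -
        Complex.I • (quadraticMatrix Q).map Complex.ofReal)⁻¹ k j *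
          regMoment Q ε (MvPolynomial.pderiv j p) := by
  set M := ((ε : ℂ) • (1 : Matrix (Fin N) (Fin N) ℂ) -
        Complex.I • (quadraticMatrix Q).map Complex.ofReal) with hM
  have h : (fun j => regMoment Q ε (MvPolynomial.pderiv j p)) =
      M.mulVec fun k => regMoment Q ε (MvPolynomial.X k * p) := by
    ext j
    exact regMoment_pderiv Q hQs hε p j
  have h2 := congrFun (congrArg M⁻¹.mulVec h) k
  rw [Matrix.mulVec_mulVec, Matrix.nonsing_inv_mul _ (isUnit_iff_ne_zero.2 hdet),
    Matrix.one_mulVec] at h2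
  exact h2.symm

theorem tendsto_regMoment_X_mul (hQs : ∀ x y, Q x y = Q y x) (hQ : Q.Nondegenerate)
    (p : MvPolynomial (Fin N) ℂ) (k : Fin N) (z : Fin N → ℂ)
    (hz : ∀ j, Tendsto (fun ε => regMoment Q ε (MvPolynomial.pderiv j p)) (𝓝[>] 0) (𝓝 (z j))) :
    Tendsto (fun ε => regMoment Q ε (MvPolynomial.X k * p)) (𝓝[>] 0)
      (𝓝 (∑ j, Complex.I * (quadraticMatrix Q)⁻¹ k j * z j)) := by
  obtain ⟨hdet, hinv⟩ := tendsto_inv_regMatrix Q hQ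
  have hlim := tendsto_finsetSum Finset.univ fun j _ =>
    ((tendsto_pi_nhds.1 (tendsto_pi_nhds.1 hinv k) j).mul (hz j))
  refine Tendsto.congr' ?_ hlim
  filter_upwards [hdet, self_mem_nhdsWithin] with ε h1 h2
  exact (regMoment_X_mul Q hQs h2 h1 p k).symm

/-- Induction on the degree: splitting off a variable x_k leaves moments of derivatives of a
monomial of lower degree. The base case is the Gaussian integral itself. -/
theorem exists_tendsto_regMoment (hQs : ∀ x y, Q x y = Q y x) (hQ : Q.Nondegenerate)
    (p : MvPolynomial (Fin N) ℂ) :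
    ∃ z : ℂ, Tendsto (fun ε => regMoment Q ε p) (𝓝[>] 0) (𝓝 z) := by
  have hC : ∀ a : ℂ, ∃ z : ℂ, Tendsto (fun ε => regMoment Q ε (MvPolynomial.C a)) (𝓝[>] 0)
      (𝓝 z) := by
    intro a
    obtain ⟨z, -, hz⟩ := exists_tendsto_regMoment_one Q hQs hQ
    refine ⟨a * z, (hz.const_mul a).congr fun ε => ?_⟩
    rw [← regMoment_C_mul, mul_one]
  -- The bound is `≤ n` rather than equality because the truncated exponent in the derivative of a
  -- monomial need not drop when that derivative is zero.
  have hmon : ∀ (n : ℕ) (d : Fin N →₀ ℕ) (a : ℂ), d.degree ≤ n →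
      ∃ z : ℂ, Tendsto (fun ε => regMoment Q ε (MvPolynomial.monomial d a)) (𝓝[>] 0) (𝓝 z) := by
    intro n
    induction n with
    | zero =>
      intro d a hd
      obtain rfl : d = 0 := (Finsupp.degree_eq_zero_iff d).1 (Nat.le_zero.1 hd)
      exact hC a
    | succ n ih =>
      intro d a hd
      by_cases h0 : d = 0
      · subst h0
        exact hC a
      obtain ⟨k, hk⟩ := Finsupp.ne_iff.1 h0
      have hle : Finsupp.single k 1 ≤ d := by
        rw [Finsupp.single_le_iff]
        exact Nat.one_le_iff_ne_zero.2 hk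
      have hdk : Finsupp.single k 1 + (d - Finsupp.single k 1) = d := add_tsub_cancel_of_le hle
      have hX : MvPolynomial.monomial d a =
          MvPolynomial.X k * MvPolynomial.monomial (d - Finsupp.single k 1) a := by
        rw [MvPolynomial.X, MvPolynomial.monomial_mul, one_mul, hdk]
      have hdeg : (d - Finsupp.single k 1).degree ≤ n := by
        have := congrArg Finsupp.degree hdk
        rw [map_add, Finsupp.degree_single] at this
        omega
      have hj : ∀ j, ∃ z : ℂ, Tendsto (fun ε => regMoment Q ε (MvPolynomial.pderiv j
          (MvPolynomial.monomial (d - Finsupp.single k 1) a))) (𝓝[>] 0) (𝓝 z) := by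
        intro j
        simp only [MvPolynomial.pderiv_monomial]
        exact ih _ _ ((Finsupp.degree_mono tsub_le_self).trans hdeg)
      choose z hz using hj
      rw [hX]
      exact ⟨_, tendsto_regMoment_X_mul Q hQs hQ _ k z hz⟩
  induction p using MvPolynomial.induction_on' with
  | monomial d a => exact hmon _ d a le_rfl
  | add p q hp hq =>
    obtain ⟨z, hz⟩ := hp
    obtain ⟨w, hw⟩ := hq
    refine ⟨z + w, (hz.add hw).congr' ?_⟩
    filter_upwards [self_mem_nhdsWithin] with ε hε
    exact (regMoment_add Q hε p q).symm

/-- The oscillatory integrals of polynomials form a linear functional, which satisfies the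
recursion given by integration by parts. -/
theorem exists_oscillatory_functional (hQs : ∀ x y, Q x y = Q y x) (hQ : Q.Nondegenerate) :
    ∃ L : MvPolynomial (Fin N) ℂ →ₗ[ℂ] ℂ, L 1 ≠ 0 ∧
      (∀ p, HasOscillatoryIntegral Q (polyFun p) (L p)) ∧
      ∀ k p, L (MvPolynomial.X k * p) =
        ∑ j, Complex.I * (quadraticMatrix Q)⁻¹ k j * L (MvPolynomial.pderiv j p) := by
  choose l hl using exists_tendsto_regMoment Q hQs hQ
  refine ⟨⟨⟨l, fun p q => ?_⟩, fun a p => ?_⟩, ?_, fun p => ⟨fun ε hε => ?_, ?_⟩, fun k p => ?_⟩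
  · refine tendsto_nhds_unique (hl (p + q)) (((hl p).add (hl q)).congr' ?_)
    filter_upwards [self_mem_nhdsWithin] with ε hε
    exact (regMoment_add Q hε p q).symm
  · refine tendsto_nhds_unique (hl (a • p)) (((hl p).const_mul a).congr fun ε => ?_)
    rw [MvPolynomial.smul_eq_C_mul, regMoment_C_mul]
  · obtain ⟨z, hz0, hz⟩ := exists_tendsto_regMoment_one Q hQs hQ
    have : l 1 = z := tendsto_nhds_unique (hl 1) hz
    change l 1 ≠ 0
    rwa [this]
  · exact integrable_regGaussian_mul_polyFun Q hε p
  · exact hl p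
  · exact tendsto_nhds_unique (hl _) (tendsto_regMoment_X_mul Q hQs hQ p k _ fun j => hl _)

/-- Oscillatory integrals of homogeneous functions scale with the quadratic form. -/
theorem HasOscillatoryIntegral.smul {Q : LinearMap.BilinForm ℝ (Fin N → ℝ)}
    {P : (Fin N → ℝ) → ℂ} {z : ℂ} (h : HasOscillatoryIntegral Q P z) (n : ℕ)
    (hP : ∀ (t : ℝ) x, 0 < t → P (t • x) = (t : ℂ) ^ n * P x) {k : ℝ} (hk : 0 < k) :
    HasOscillatoryIntegral (k • Q) P (((k ^ (-(N : ℝ) / 2 - n / 2) : ℝ) : ℂ) * z) := by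
  set t : ℝ := √k with ht
  have ht0 : 0 < t := Real.sqrt_pos.2 hk
  have htk : t ^ 2 = k := Real.sq_sqrt hk.le
  -- The substitution x ↦ √k x turns kQ into Q and ε into ε/k. The Jacobian gives k^{-N/2} and
  -- homogeneity gives k^{-n/2}.
  set f : ℝ → (Fin N → ℝ) → ℂ := fun ε x =>
    Complex.exp (Complex.I / 2 * (Q x x + Complex.I * ε * ∑ j, (x j : ℂ) ^ 2)) * P x with hf
  have hpow : k ^ (-(N : ℝ) / 2 - n / 2) = (t ^ n)⁻¹ * (t ^ N)⁻¹ := by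
    rw [← htk, ← Real.rpow_natCast t 2, ← Real.rpow_mul ht0.le, ← Real.rpow_natCast t n,
      ← Real.rpow_natCast t N, ← Real.rpow_neg ht0.le, ← Real.rpow_neg ht0.le,
      ← Real.rpow_add ht0]
    congr 1
    push_cast
    ring
  have hfun : ∀ ε : ℝ, (fun x : Fin N → ℝ => Complex.exp (Complex.I / 2 *
      (((k • Q) x x : ℝ) + Complex.I * ε * ∑ j, (x j : ℂ) ^ 2)) * P x) =
      fun x => ((t ^ n)⁻¹ : ℝ) * f (ε / k) (t • x) := by
    intro ε
    ext x
    have h1 : Q (t • x) (t • x) = k * Q x x := by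
      simp only [map_smul, LinearMap.smul_apply, smul_eq_mul, ← htk]; ring
    have h2 : ∑ j, (((t • x) j : ℝ) : ℂ) ^ 2 = k * ∑ j, (x j : ℂ) ^ 2 := by
      simp only [Pi.smul_apply, smul_eq_mul, ← htk, Finset.mul_sum]
      push_cast
      exact Finset.sum_congr rfl fun j _ => by ring
    have hkc : (k : ℂ) ≠ 0 := by exact_mod_cast hk.ne'
    have htc : (t : ℂ) ≠ 0 := by exact_mod_cast ht0.ne'
    simp only [hf, h1, h2, hP t x ht0, LinearMap.smul_apply, smul_eq_mul]
    have h3 : Complex.I * ((ε / k : ℝ) : ℂ) * (k * ∑ j, (x j : ℂ) ^ 2) =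
        Complex.I * ε * ∑ j, (x j : ℂ) ^ 2 := by
      push_cast
      field_simp
    rw [h3]
    push_cast
    field_simp
  refine ⟨fun ε hε => ?_, ?_⟩
  · rw [hfun]
    exact ((h.1 (ε / k) (div_pos hε hk)).comp_smul ht0.ne').const_mul _
  · simp only [hfun, integral_const_mul, Measure.integral_comp_smul, Module.finrank_fin_fun]
    have hd : Tendsto (fun ε : ℝ => ε / k) (𝓝[>] 0) (𝓝[>] 0) := by
      refine tendsto_nhdsWithin_iff.2 ⟨?_, ?_⟩
      · have : Tendsto (fun ε : ℝ => ε / k) (𝓝 0) (𝓝 (0 / k)) := tendsto_id.div_const k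
        rw [zero_div] at this
        exact this.mono_left nhdsWithin_le_nhds
      · filter_upwards [self_mem_nhdsWithin] with ε hε
        exact div_pos hε hk
    have := (((h.2.comp hd).const_smul |((t ^ N)⁻¹ : ℝ)|).const_mul (((t ^ n)⁻¹ : ℝ) : ℂ))
    rw [hpow]
    have hz : ((((t ^ n)⁻¹ * (t ^ N)⁻¹ : ℝ) : ℂ) * z) =
        (((t ^ n)⁻¹ : ℝ) : ℂ) * |((t ^ N)⁻¹ : ℝ)| • z := by
      rw [abs_of_pos (by positivity), Complex.real_smul, Complex.ofReal_mul, mul_assoc]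
    rw [hz]
    exact this

end GaussianLimit

/-! ### The formal logarithm -/

open PowerSeries in
-- Since (log F)' F = F', both log F and G have derivative F'/F, and both have constant term 0.
theorem logOf_eq_of_derivative {F G : ℂ⟦X⟧} (hF : constantCoeff F = 1) (hG : constantCoeff G = 0)
    (h : d⁄dX ℂ F = d⁄dX ℂ G * F) : logOf F = G := by
  have hs : HasSubst (F - 1) := HasSubst.of_constantCoeff_zero' (by simp [hF])
  have hd : d⁄dX ℂ (log ℂ) * (1 + X) = 1 := by
    rw [deriv_log]
    ext n
    rw [mul_add, mul_one, map_add]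
    cases n with
    | zero => simp
    | succ n => simp [coeff_succ_mul_X, coeff_one, pow_succ]
  have h1 : (d⁄dX ℂ (log ℂ)).subst (F - 1) * F = 1 := by
    have := congrArg (PowerSeries.subst (F - 1)) hd
    rw [← coe_substAlgHom hs, map_mul, map_add, map_one, coe_substAlgHom hs, subst_X hs] at this
    simpa using this
  have hF0 : F ≠ 0 := by
    rintro rfl
    simp at hF
  refine derivative.ext ?_ (by rw [constantCoeff_logOf hF, hG])
  refine mul_right_cancel₀ hF0 ?_
  rw [← h, logOf_eq, derivative_subst hs, map_sub, derivative_one, sub_zero,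
    mul_right_comm, h1, one_mul]

/-- The logarithm of an even power series is determined by the recursion
`m a_m = ∑_k k c_k a_{m-k}` between coefficients. -/
theorem coeff_logOf_even {F : ℂ⟦X⟧} {a c : ℕ → ℂ}
    (hodd : ∀ m, F.coeff (2 * m + 1) = 0) (heven : ∀ m, F.coeff (2 * m) = a m)
    (ha : a 0 = 1) (hc : c 0 = 0)
    (h : ∀ m, m * a m = ∑ k ∈ Finset.range (m + 1), k * c k * a (m - k)) :
    (∀ m, (PowerSeries.logOf F).coeff (2 * m + 1) = 0) ∧
      ∀ m, (PowerSeries.logOf F).coeff (2 * m) = c m := by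
  have hs : PowerSeries.HasSubst (PowerSeries.X ^ 2 : ℂ⟦X⟧) := .X_pow two_ne_zero
  -- Vanishing odd coefficients mean that F is a series in X², so the recursion can be read as a
  -- differential equation in the variable X².
  have hF : F = (PowerSeries.mk a).subst (PowerSeries.X ^ 2 : ℂ⟦X⟧) := by
    ext n
    rw [PowerSeries.coeff_subst_X_pow two_ne_zero]
    rcases Nat.even_or_odd' n with ⟨m, rfl | rfl⟩
    · simp [heven]
    · rw [hodd, if_neg (by omega)]
  have hd : PowerSeries.derivative ℂ (PowerSeries.mk a) =
      PowerSeries.derivative ℂ (PowerSeries.mk c) * PowerSeries.mk a := by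
    ext n
    have hn := h (n + 1)
    -- The k = 0 term is split off: its factor k makes it vanish, and the rest is the Cauchy product
    -- of the derivative with `a`.
    rw [Finset.sum_range_succ'] at hn
    rw [PowerSeries.coeff_mul, Finset.Nat.sum_antidiagonal_eq_sum_range_succ_mk]
    simp only [PowerSeries.coeff_derivative, PowerSeries.coeff_mk]
    push_cast at hn
    rw [mul_comm, hn, zero_mul, zero_mul, add_zero]
    refine Finset.sum_congr rfl fun k _ => ?_
    ring
  have hlog : PowerSeries.logOf F =
      (PowerSeries.mk c).subst (PowerSeries.X ^ 2 : ℂ⟦X⟧) := by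
    refine logOf_eq_of_derivative ?_ ?_ ?_
    · rw [← PowerSeries.coeff_zero_eq_constantCoeff_apply]
      exact (heven 0).trans ha
    · rw [PowerSeries.constantCoeff_subst_X_pow two_ne_zero]
      simp [hc]
    · rw [hF, PowerSeries.derivative_subst hs, PowerSeries.derivative_subst hs, hd,
        ← PowerSeries.coe_substAlgHom hs, map_mul]
      ring
  rw [hlog]
  refine ⟨fun m => ?_, fun m => ?_⟩
  · rw [PowerSeries.coeff_subst_X_pow two_ne_zero, if_neg (by omega)]
  · rw [PowerSeries.coeff_subst_X_pow two_ne_zero]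
    simp

/-! ### Counting trivalent graphs by orbits -/

namespace TrivalentGraph

variable {H K L : Type*}

theorem ext_edges_vertices {Γ Δ : TrivalentGraph H} (he : Γ.edges = Δ.edges)
    (hv : Γ.vertices = Δ.vertices) : Γ = Δ := by
  cases Γ; cases Δ
  simp only at he hv
  subst he hv
  rfl

/-- This makes isomorphism classes the orbits, and automorphism groups the stabilizers, of the
action of permutations by relabelling. -/
theorem isIso_iff_relabel_eq {Γ : TrivalentGraph H} {Δ : TrivalentGraph K} {σ : H ≃ K} :
    Γ.IsIso Δ σ ↔ Γ.relabel σ = Δ := by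
  constructor
  · intro h
    have key : ∀ A : Finset (Finset H), ∀ B : Finset (Finset K),
        (∀ s, s ∈ A ↔ s.map σ.toEmbedding ∈ B) →
        A.map (Finset.mapEmbedding σ.toEmbedding).toEmbedding = B := by
      intro A B hAB
      ext s
      rw [Finset.mem_map]
      constructor
      · rintro ⟨t, ht, rfl⟩
        exact (hAB t).1 ht
      · intro hs
        have hst : (s.map σ.symm.toEmbedding).map σ.toEmbedding = s := by
          ext; simp
        exact ⟨s.map σ.symm.toEmbedding, (hAB _).2 (by rwa [hst]), hst⟩
    exact ext_edges_vertices (key _ _ h.1) (key _ _ h.2)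
  · rintro rfl
    exact Γ.isIso_relabel σ

theorem relabel_trans (Γ : TrivalentGraph H) (σ : H ≃ K) (τ : K ≃ L) :
    Γ.relabel (σ.trans τ) = (Γ.relabel σ).relabel τ :=
  isIso_iff_relabel_eq.1 ((Γ.isIso_relabel σ).trans ((Γ.relabel σ).isIso_relabel τ))

theorem relabel_refl (Γ : TrivalentGraph H) : Γ.relabel (Equiv.refl H) = Γ :=
  isIso_iff_relabel_eq.1 (IsIso.refl Γ)

/-- Renaming half-edges is a bijection between sets of graphs. -/
def relabelEquiv (σ : H ≃ K) : TrivalentGraph H ≃ TrivalentGraph K where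
  toFun Γ := Γ.relabel σ
  invFun Γ := Γ.relabel σ.symm
  left_inv Γ := by beta_reduce; rw [← relabel_trans, Equiv.self_trans_symm, relabel_refl]
  right_inv Γ := by beta_reduce; rw [← relabel_trans, Equiv.symm_trans_self, relabel_refl]

instance : MulAction (Equiv.Perm H) (TrivalentGraph H) where
  smul σ Γ := Γ.relabel σ
  one_smul := relabel_refl
  mul_smul σ τ Γ := relabel_trans Γ τ σ

/-- A trivalent graph has twice as many half-edges as edges. -/
theorem card_halfEdges_eq_two_mul [Fintype H] (Γ : TrivalentGraph H) :
    Fintype.card H = 2 * Γ.edges.card := by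
  classical
  have hU : Γ.edges.biUnion id = Finset.univ := by
    ext h
    obtain ⟨v, ⟨hv, hh⟩, -⟩ := Γ.existsUnique_edge h
    simpa using ⟨v, hv, hh⟩
  have hd : (Γ.edges : Set (Finset H)).PairwiseDisjoint id := by
    intro v hv w hw hvw
    refine Finset.disjoint_left.2 fun h h1 h2 => hvw ?_
    exact (Γ.existsUnique_edge h).unique ⟨hv, h1⟩ ⟨hw, h2⟩
  rw [← Finset.card_univ, ← hU, Finset.card_biUnion hd, mul_comm]
  exact Finset.sum_const_nat fun v hv => Γ.card_of_mem_edges v hv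

end TrivalentGraph

/-- A partition of `H` into three-element subsets. -/
structure IsTriplePartition {H : Type*} (P : Finset (Finset H)) : Prop where
  card_eq : ∀ v ∈ P, v.card = 3
  existsUnique : ∀ h : H, ∃! v, v ∈ P ∧ h ∈ v

theorem TrivalentGraph.isTriplePartition {H : Type*} (Γ : TrivalentGraph H) :
    IsTriplePartition Γ.vertices :=
  ⟨Γ.card_of_mem_vertices, Γ.existsUnique_vertex⟩

/-- The permutations which preserve a set of subsets. -/
def partitionStabilizer {H : Type*} (P : Finset (Finset H)) : Subgroup (Equiv.Perm H) where
  carrier := {σ | ∀ s : Finset H, s ∈ P ↔ s.map σ.toEmbedding ∈ P}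
  one_mem' := fun s => by
    have : s.map (1 : Equiv.Perm H).toEmbedding = s := Finset.map_refl
    rw [this]
  mul_mem' := fun {a b} ha hb s => by
    rw [hb, ha, Finset.map_map]
    rfl
  inv_mem' := fun {a} ha s => by
    rw [ha (s.map _), Finset.map_map]
    have : s.map ((a⁻¹).toEmbedding.trans a.toEmbedding) = s := by ext; simp
    rw [this]

/-- An injective self-map of the finite set `P` is onto, so one inclusion suffices. -/
theorem mem_iff_map_mem_of_forall_mem {H : Type*} {P : Finset (Finset H)} {σ : Equiv.Perm H}
    (h : ∀ s ∈ P, s.map σ.toEmbedding ∈ P)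
    (s : Finset H) : s ∈ P ↔ s.map σ.toEmbedding ∈ P := by
  refine ⟨h s, fun hs => ?_⟩
  have hsub : P.map (Finset.mapEmbedding σ.toEmbedding).toEmbedding ⊆ P := by
    intro t ht
    obtain ⟨u, hu, rfl⟩ := Finset.mem_map.1 ht
    exact h u hu
  have heq := Finset.eq_of_subset_of_card_le hsub (by rw [Finset.card_map])
  rw [← heq] at hs
  obtain ⟨u, hu, hus⟩ := Finset.mem_map.1 hs
  rwa [← (Finset.mapEmbedding σ.toEmbedding).injective hus]

/-! ### Symmetries of a partition into triples -/

namespace IsTriplePartition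

variable {H : Type*} [Fintype H] {P : Finset (Finset H)}

/-- The half-edges of a triple partition are numbered by the triples and `Fin 3`. -/
theorem exists_equiv (hP : IsTriplePartition P) :
    ∃ e : H ≃ P × Fin 3, ∀ (h : H) (v : P), h ∈ v.1 ↔ (e h).1 = v := by
  classical
  choose f hf hu using hP.existsUnique
  let g : H → P := fun h => ⟨f h, (hf h).1⟩
  have hg : ∀ (h : H) (v : P), h ∈ v.1 ↔ g h = v := by
    intro h v
    constructor
    · intro hv
      exact Subtype.ext (hu h v.1 ⟨v.2, hv⟩).symm
    · rintro rfl
      exact (hf h).2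
  have hc : ∀ v : P, Nonempty ({h // g h = v} ≃ Fin 3) := by
    intro v
    refine ⟨Fintype.equivFinOfCardEq ?_⟩
    rw [Fintype.card_subtype, ← hP.card_eq v.1 v.2]
    congr 1
    ext h
    simp [hg]
  let e := (Equiv.sigmaFiberEquiv g).symm.trans
    ((Equiv.sigmaCongrRight fun v => (hc v).some).trans (Equiv.sigmaEquivProd P (Fin 3)))
  exact ⟨e, fun h v => hg h v⟩

theorem card_eq_three_mul (hP : IsTriplePartition P) : Fintype.card H = 3 * P.card := by
  obtain ⟨e, -⟩ := hP.exists_equiv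
  rw [Fintype.card_congr e, Fintype.card_prod, Fintype.card_coe, Fintype.card_fin, mul_comm]

/-- There are `n! 6^n` permutations which preserve a partition into `n` triples. -/
theorem card_partitionStabilizer (hP : IsTriplePartition P) :
    Nat.card (partitionStabilizer P) = P.card.factorial * 6 ^ P.card := by
  classical
  obtain ⟨e, he⟩ := hP.exists_equiv
  have he' : ∀ (x : P × Fin 3) (v : P), e.symm x ∈ v.1 ↔ x.1 = v := by
    intro x v
    rw [he, Equiv.apply_symm_apply]
  -- The stabilizer is a wreath product: a permutation of the triples together with a permutation of
  -- the three slots of each. This is the source of the factors n! and 6^n.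
  let Ψ : Equiv.Perm P × (P → Equiv.Perm (Fin 3)) → Equiv.Perm H := fun x =>
    (e.trans (Equiv.prodShear x.1 x.2)).trans e.symm
  have hΨ : ∀ x, Ψ x ∈ partitionStabilizer P := by
    intro x
    refine mem_iff_map_mem_of_forall_mem fun s hs => ?_
    have : s.map (Ψ x).toEmbedding = (x.1 ⟨s, hs⟩).1 := by
      ext h
      rw [Finset.mem_map_equiv, he _ (x.1 ⟨s, hs⟩), he _ ⟨s, hs⟩]
      simp [Ψ, Equiv.symm_apply_eq]
    rw [this]
    exact (x.1 ⟨s, hs⟩).2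
  have hinj : Function.Injective Ψ := by
    intro x y hxy
    have h1 : ∀ (v : P) (r : Fin 3), (x.1 v, x.2 v r) = (y.1 v, y.2 v r) := by
      intro v r
      have := congrArg (fun σ : Equiv.Perm H => e (σ (e.symm (v, r)))) hxy
      simpa [Ψ] using this
    refine Prod.ext (Equiv.ext fun v => congrArg Prod.fst (h1 v 0)) ?_
    funext v
    exact Equiv.ext fun r => congrArg Prod.snd (h1 v r)
  have hsurj : ∀ σ ∈ partitionStabilizer P, ∃ x, Ψ x = σ := by
    intro σ hσ
    let t : P → P := fun v => ⟨v.1.map σ.toEmbedding, (hσ v.1).1 v.2⟩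
    have ht : Function.Injective t := by
      intro v w hvw
      exact Subtype.ext (Finset.map_injective _ (congrArg Subtype.val hvw))
    have h1 : ∀ x, (e (σ (e.symm x))).1 = t x.1 := by
      intro x
      rw [← he]
      simp only [t, Finset.mem_map_equiv]
      rw [Equiv.symm_apply_apply, he']
    let ρ : P → Fin 3 → Fin 3 := fun v r => (e (σ (e.symm (v, r)))).2
    have hρ : ∀ v, Function.Injective (ρ v) := by
      intro v r r' hr
      have : e (σ (e.symm (v, r))) = e (σ (e.symm (v, r'))) :=
        Prod.ext ((h1 (v, r)).trans (h1 (v, r')).symm) hr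
      simpa using this
    refine ⟨(Equiv.ofBijective t (Finite.injective_iff_bijective.1 ht),
      fun v => Equiv.ofBijective (ρ v) (Finite.injective_iff_bijective.1 (hρ v))), ?_⟩
    refine Equiv.ext fun h => ?_
    have h2 : (t (e h).1, ρ (e h).1 (e h).2) = e (σ h) :=
      Prod.ext (by rw [← h1, Equiv.symm_apply_apply]) (by simp [ρ])
    change e.symm (t (e h).1, ρ (e h).1 (e h).2) = σ h
    rw [h2, Equiv.symm_apply_apply]
  have hb : Function.Bijective fun x => (⟨Ψ x, hΨ x⟩ : partitionStabilizer P) :=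
    ⟨fun x y hxy => hinj (congrArg Subtype.val hxy),
      fun σ => (hsurj σ.1 σ.2).imp fun x hx => Subtype.ext hx⟩
  rw [← Nat.card_congr (Equiv.ofBijective _ hb), Nat.card_prod, Nat.card_perm,
    Nat.card_eq_fintype_card, Fintype.card_coe, Nat.card_fun, Nat.card_perm,
    Nat.card_eq_fintype_card, Nat.card_eq_fintype_card, Fintype.card_coe, Fintype.card_fin]
  rfl

/-- Any two triple partitions are carried into each other by a permutation. -/
theorem exists_perm_map_eq {P' : Finset (Finset H)} (hP : IsTriplePartition P)
    (hP' : IsTriplePartition P') :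
    ∃ σ : Equiv.Perm H, P.map (Finset.mapEmbedding σ.toEmbedding).toEmbedding = P' := by
  classical
  obtain ⟨e, he⟩ := hP.exists_equiv
  obtain ⟨e', he'⟩ := hP'.exists_equiv
  have hc : P.card = P'.card := by
    have := hP.card_eq_three_mul.symm.trans hP'.card_eq_three_mul
    omega
  obtain ⟨τ⟩ : Nonempty (P ≃ P') := ⟨Finset.equivOfCardEq hc⟩
  let σ : Equiv.Perm H := (e.trans (τ.prodCongr (Equiv.refl _))).trans e'.symm
  refine ⟨σ, Finset.eq_of_subset_of_card_le (fun t ht => ?_) (by rw [Finset.card_map, hc])⟩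
  obtain ⟨s, hs, rfl⟩ := Finset.mem_map.1 ht
  have : s.map σ.toEmbedding = (τ ⟨s, hs⟩).1 := by
    ext h
    rw [Finset.mem_map_equiv, he' _ (τ ⟨s, hs⟩), he _ ⟨s, hs⟩]
    simp [σ, Equiv.symm_apply_eq]
  change s.map σ.toEmbedding ∈ P'
  rw [this]
  exact (τ ⟨s, hs⟩).2

end IsTriplePartition

/-! ### Orbit-stabilizer counts of graphs and gluings -/

namespace TrivalentGraph

variable {H : Type*}

theorem mem_aut_iff (Γ : TrivalentGraph H) (σ : Equiv.Perm H) : σ ∈ Γ.Aut ↔ σ • Γ = Γ :=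
  isIso_iff_relabel_eq

/-- Orbit-stabilizer for the full permutation group of the half-edges. -/
theorem card_iso_mul_card_aut [Fintype H] (Γ : TrivalentGraph H) :
    Nat.card {Δ : TrivalentGraph H // ∃ σ : Equiv.Perm H, Γ.IsIso Δ σ} * Nat.card Γ.Aut =
      (Fintype.card H).factorial := by
  have e := MulAction.orbitProdStabilizerEquivGroup (Equiv.Perm H) Γ
  have h1 : MulAction.stabilizer (Equiv.Perm H) Γ = Γ.Aut := by
    ext σ
    rw [mem_aut_iff, MulAction.mem_stabilizer_iff]
  have h2 : MulAction.orbit (Equiv.Perm H) Γ = {Δ | ∃ σ : Equiv.Perm H, Γ.IsIso Δ σ} := by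
    ext Δ
    simp only [MulAction.mem_orbit_iff, Set.mem_ofPred_eq, isIso_iff_relabel_eq]
    rfl
  rw [h1, h2] at e
  have := Nat.card_congr e
  rw [Nat.card_prod, Nat.card_perm, Nat.card_eq_fintype_card (α := H)] at this
  exact this

/-- The number of gluings of the legs of fixed vertices which give a graph isomorphic to `Γ`. -/
theorem card_gluings_mul_card_aut [Fintype H] (Γ : TrivalentGraph H) :
    Nat.card {Δ : TrivalentGraph H //
        Δ.vertices = Γ.vertices ∧ ∃ σ : Equiv.Perm H, Γ.IsIso Δ σ} * Nat.card Γ.Aut =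
      Γ.vertices.card.factorial * 6 ^ Γ.vertices.card := by
  rw [← Γ.isTriplePartition.card_partitionStabilizer]
  set S := partitionStabilizer Γ.vertices with hS
  have e := MulAction.orbitProdStabilizerEquivGroup S Γ
  -- Automorphisms already preserve the vertices, so restricting to the smaller group does not
  -- change the stabilizer.
  have hAut : Γ.Aut ≤ S := fun σ hσ => hσ.2
  have h1 : Nat.card (MulAction.stabilizer S Γ) = Nat.card Γ.Aut :=
    Nat.card_congr
      { toFun := fun σ => ⟨σ.1.1, (mem_aut_iff _ _).2 σ.2⟩
        invFun := fun σ => ⟨⟨σ.1, hAut σ.2⟩, (mem_aut_iff _ _).1 σ.2⟩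
        left_inv := fun _ => rfl
        right_inv := fun _ => rfl }
  have h2 : MulAction.orbit S Γ =
      {Δ | Δ.vertices = Γ.vertices ∧ ∃ σ : Equiv.Perm H, Γ.IsIso Δ σ} := by
    ext Δ
    rw [MulAction.mem_orbit_iff, Set.mem_ofPred_eq]
    constructor
    · rintro ⟨σ, rfl⟩
      have hiso : Γ.IsIso (σ.1 • Γ) σ.1 := Γ.isIso_relabel σ.1
      refine ⟨?_, σ.1, hiso⟩
      ext s
      have hst : (s.map σ.1.symm.toEmbedding).map σ.1.toEmbedding = s := by ext; simp
      have h3 := hiso.2 (s.map σ.1.symm.toEmbedding)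
      have h4 := σ.2 (s.map σ.1.symm.toEmbedding)
      rw [hst] at h3 h4
      exact h3.symm.trans h4
    · rintro ⟨hv, σ, hσ⟩
      refine ⟨⟨σ, fun s => ?_⟩, isIso_iff_relabel_eq.1 hσ⟩
      have := hσ.2 s
      rwa [hv] at this
  rw [h2] at e
  rw [← Nat.card_congr e, Nat.card_prod, h1]
  rfl

end TrivalentGraph

/-! ### Sums over graphs and sums over isomorphism classes -/

noncomputable instance TrivalentGraph.instFintype {H : Type*} [Finite H] :
    Fintype (TrivalentGraph H) :=
  Fintype.ofFinite _

/-- The isomorphism class of a trivalent graph. -/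
def GraphClass.mk {m : ℕ} (Γ : TrivalentGraph (Fin (6 * m))) : GraphClass m := Quotient.mk _ Γ

theorem GraphClass.mk_surjective {m : ℕ} (γ : GraphClass m) : ∃ Γ, GraphClass.mk Γ = γ :=
  Quotient.exists_rep γ

theorem GraphClass.mk_eq_mk_iff {m : ℕ} {Γ Δ : TrivalentGraph (Fin (6 * m))} :
    GraphClass.mk Γ = GraphClass.mk Δ ↔ ∃ σ : Equiv.Perm (Fin (6 * m)), Γ.IsIso Δ σ :=
  Quotient.eq

-- If each class meets `T` in n/|Aut Γ| graphs, summing a class function over `T` weights each class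
-- by exactly that number.
open Classical in
theorem sum_eq_sum_graphClass {m : ℕ} (T : Finset (TrivalentGraph (Fin (6 * m)))) (n : ℕ)
    (hT : ∀ Γ : TrivalentGraph (Fin (6 * m)),
      (T.filter fun Δ => ∃ σ : Equiv.Perm (Fin (6 * m)), Γ.IsIso Δ σ).card * Nat.card Γ.Aut = n)
    (F : GraphClass m → ℝ) :
    ∑ Γ ∈ T, F (GraphClass.mk Γ) = n * ∑ γ : GraphClass m, F γ / γ.autCard := by
  rw [Finset.mul_sum, ← Finset.sum_fiberwise (κ := GraphClass m) T GraphClass.mk]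
  refine Finset.sum_congr rfl fun γ _ => ?_
  obtain ⟨Γ, rfl⟩ := GraphClass.mk_surjective γ
  rw [Finset.sum_congr rfl (g := fun _ => F (GraphClass.mk Γ))
    (fun Δ hΔ => by rw [(Finset.mem_filter.1 hΔ).2]), Finset.sum_const, nsmul_eq_mul]
  have hfil : (T.filter fun Δ => GraphClass.mk Δ = GraphClass.mk Γ) =
      T.filter fun Δ => ∃ σ : Equiv.Perm (Fin (6 * m)), Γ.IsIso Δ σ := by
    refine Finset.filter_congr fun Δ _ => ?_
    exact eq_comm.trans GraphClass.mk_eq_mk_iff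
  have hpos : (0 : ℝ) < Nat.card Γ.Aut := by exact_mod_cast Nat.card_pos
  have haut : (GraphClass.autCard (GraphClass.mk Γ) : ℝ) = Nat.card Γ.Aut := rfl
  rw [hfil, haut, ← hT Γ, Nat.cast_mul]
  field_simp

open Classical in
/-- Each class of graphs has `(6m)! / |Aut Γ|` members. -/
theorem sum_univ_eq_sum_graphClass {m : ℕ} (F : GraphClass m → ℝ) :
    ∑ Γ : TrivalentGraph (Fin (6 * m)), F (GraphClass.mk Γ) =
      (6 * m).factorial * ∑ γ : GraphClass m, F γ / γ.autCard := by
  refine sum_eq_sum_graphClass _ _ (fun Γ => ?_) F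
  rw [← Fintype.card_subtype, ← Nat.card_eq_fintype_card, Γ.card_iso_mul_card_aut,
    Fintype.card_fin]

-- A class need not be represented by a graph already having vertex set `P`, but any two triple
-- partitions are conjugate, so one may relabel and then apply the count of gluings.
open Classical in
theorem sum_vertices_eq_sum_graphClass {m : ℕ} {P : Finset (Finset (Fin (6 * m)))}
    (hP : IsTriplePartition P) (F : GraphClass m → ℝ) :
    ∑ Γ : TrivalentGraph (Fin (6 * m)) with Γ.vertices = P, F (GraphClass.mk Γ) =
      ((2 * m).factorial * 6 ^ (2 * m) : ℕ) * ∑ γ : GraphClass m, F γ / γ.autCard := by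
  refine sum_eq_sum_graphClass _ _ (fun Γ => ?_) F
  obtain ⟨σ, hσ⟩ := Γ.isTriplePartition.exists_perm_map_eq hP
  have hΓ' : (Γ.relabel σ).vertices = P := hσ
  have hc : P.card = 2 * m := by
    have := hP.card_eq_three_mul
    rw [Fintype.card_fin] at this
    omega
  have key := (Γ.relabel σ).card_gluings_mul_card_aut
  rw [hΓ', hc, ← (Γ.isIso_relabel σ).card_aut_eq] at key
  rw [← key, Finset.filter_filter, ← Fintype.card_subtype, ← Nat.card_eq_fintype_card]
  congr 1
  refine Nat.card_congr (Equiv.subtypeEquivRight fun Δ => and_congr_right fun _ => ⟨?_, ?_⟩)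
  · rintro ⟨τ, hτ⟩
    exact ⟨_, (Γ.isIso_relabel σ).symm.trans hτ⟩
  · rintro ⟨τ, hτ⟩
    exact ⟨_, (Γ.isIso_relabel σ).trans hτ⟩

/-! ### Total weights of graphs on labelled half-edges -/

section TotalWeight

variable {N : ℕ} (Q : LinearMap.BilinForm ℝ (Fin N → ℝ))
  (V : MultilinearMap ℝ (fun _ : Fin 3 => Fin N → ℝ) ℝ)

/-- The sum of the weights of all trivalent graphs with set of half-edges `H`. -/
noncomputable def totalWeight (H : Type*) [Fintype H] [DecidableEq H] : ℝ :=
  ∑ Γ : TrivalentGraph H, Γ.weight Q V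

open Classical in
/-- The sum of the weights of all connected trivalent graphs with set of half-edges `H`. -/
noncomputable def connectedTotalWeight (H : Type*) [Fintype H] [DecidableEq H] : ℝ :=
  ∑ Γ : TrivalentGraph H with Γ.Connected, Γ.weight Q V

variable {H K : Type*} [Fintype H] [DecidableEq H] [Fintype K] [DecidableEq K]

theorem totalWeight_congr (σ : H ≃ K) : totalWeight Q V H = totalWeight Q V K :=
  Fintype.sum_equiv (TrivalentGraph.relabelEquiv σ) _ _ fun Γ =>
    (Γ.isIso_relabel σ).weight_eq Q V

theorem connectedTotalWeight_congr (σ : H ≃ K) :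
    connectedTotalWeight Q V H = connectedTotalWeight Q V K := by
  classical
  unfold connectedTotalWeight
  rw [Finset.sum_filter, Finset.sum_filter]
  refine Fintype.sum_equiv (TrivalentGraph.relabelEquiv σ) _ _ fun Γ => ?_
  have h := Γ.isIso_relabel σ
  have hc : Γ.Connected ↔ (TrivalentGraph.relabelEquiv σ Γ).Connected :=
    ⟨h.connected, h.symm.connected⟩
  rw [h.weight_eq Q V]
  simp only [hc]
  rfl

theorem six_dvd_card {H : Type*} [Fintype H] (Γ : TrivalentGraph H) : 6 ∣ Fintype.card H := by
  have h1 := Γ.card_halfEdges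
  have h2 := Γ.card_halfEdges_eq_two_mul
  omega

theorem connectedTotalWeight_eq_zero (h : ¬ 6 ∣ Fintype.card H) :
    connectedTotalWeight Q V H = 0 :=
  Finset.sum_eq_zero fun Γ _ => absurd (six_dvd_card Γ) h

theorem totalWeight_fin (m : ℕ) :
    totalWeight Q V (Fin (6 * m)) = (6 * m).factorial * graphSum Q V m :=
  sum_univ_eq_sum_graphClass fun γ => γ.weight Q V

theorem connectedTotalWeight_fin (m : ℕ) :
    connectedTotalWeight Q V (Fin (6 * m)) = (6 * m).factorial * connectedGraphSum Q V m := by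
  classical
  have h := sum_univ_eq_sum_graphClass fun γ : GraphClass m =>
    if γ.Connected then γ.weight Q V else 0
  rw [connectedTotalWeight, connectedGraphSum, Finset.sum_filter, Finset.sum_filter]
  simp only [ite_div, zero_div] at h
  convert h using 2
  rfl

open Classical in
theorem sum_vertices_weight_eq (m : ℕ) (hH : Fintype.card H = 6 * m) {P : Finset (Finset H)}
    (hP : IsTriplePartition P) :
    ∑ Γ : TrivalentGraph H with Γ.vertices = P, Γ.weight Q V =
      ((2 * m).factorial * 6 ^ (2 * m) : ℕ) * graphSum Q V m := by
  let σ : H ≃ Fin (6 * m) := Fintype.equivFinOfCardEq hH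
  have hP' : IsTriplePartition (P.map (Finset.mapEmbedding σ.toEmbedding).toEmbedding) := by
    refine ⟨fun v hv => ?_, fun h => ?_⟩
    · obtain ⟨s, hs, rfl⟩ := Finset.mem_map.1 hv
      exact (Finset.card_map _).trans (hP.card_eq s hs)
    · obtain ⟨v, ⟨hv, hh⟩, hu⟩ := hP.existsUnique (σ.symm h)
      refine ⟨v.map σ.toEmbedding, ⟨Finset.mem_map.2 ⟨v, hv, rfl⟩, by simpa using hh⟩, ?_⟩
      rintro f ⟨hf, hhf⟩
      obtain ⟨s, hs, rfl⟩ := Finset.mem_map.1 hf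
      rw [← hu s ⟨hs, by simpa using hhf⟩]
      rfl
  refine Eq.trans ?_ (sum_vertices_eq_sum_graphClass hP' fun γ => γ.weight Q V)
  rw [Finset.sum_filter, Finset.sum_filter]
  refine Fintype.sum_equiv (TrivalentGraph.relabelEquiv σ) _ _ fun Γ => ?_
  have hv : (TrivalentGraph.relabelEquiv σ Γ).vertices =
      P.map (Finset.mapEmbedding σ.toEmbedding).toEmbedding ↔ Γ.vertices = P :=
    (Finset.map_injective _).eq_iff
  simp only [hv]
  rw [(Γ.isIso_relabel σ).weight_eq Q V]
  rfl

end TotalWeight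

/-! ### Disjoint unions and the exponential formula -/

section Blocks

variable {K L : Type*}

open Classical in
/-- The disjoint union of two sets of subsets. -/
noncomputable def sumBlocks (A : Finset (Finset K)) (B : Finset (Finset L)) :
    Finset (Finset (K ⊕ L)) :=
  A.map (Finset.mapEmbedding Function.Embedding.inl).toEmbedding ∪
    B.map (Finset.mapEmbedding Function.Embedding.inr).toEmbedding

theorem mem_sumBlocks {A : Finset (Finset K)} {B : Finset (Finset L)} {s : Finset (K ⊕ L)} :
    s ∈ sumBlocks A B ↔ (∃ t ∈ A, t.map Function.Embedding.inl = s) ∨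
      ∃ t ∈ B, t.map Function.Embedding.inr = s := by
  simp only [sumBlocks, Finset.mem_union, Finset.mem_map]
  rfl

theorem card_of_mem_sumBlocks {A : Finset (Finset K)} {B : Finset (Finset L)} {n : ℕ}
    (hA : ∀ s ∈ A, s.card = n) (hB : ∀ s ∈ B, s.card = n) :
    ∀ s ∈ sumBlocks A B, s.card = n := by
  intro s hs
  rcases mem_sumBlocks.1 hs with ⟨t, ht, rfl⟩ | ⟨t, ht, rfl⟩
  · rw [Finset.card_map, hA t ht]
  · rw [Finset.card_map, hB t ht]

theorem existsUnique_mem_sumBlocks {A : Finset (Finset K)} {B : Finset (Finset L)}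
    (hA : ∀ h : K, ∃! s, s ∈ A ∧ h ∈ s) (hB : ∀ h : L, ∃! s, s ∈ B ∧ h ∈ s) :
    ∀ h : K ⊕ L, ∃! s, s ∈ sumBlocks A B ∧ h ∈ s := by
  rintro (h | h)
  · obtain ⟨s, ⟨hs, hh⟩, hu⟩ := hA h
    refine ⟨s.map Function.Embedding.inl, ⟨mem_sumBlocks.2 (Or.inl ⟨s, hs, rfl⟩), by simpa⟩, ?_⟩
    rintro t ⟨ht, hht⟩
    rcases mem_sumBlocks.1 ht with ⟨u, hu', rfl⟩ | ⟨u, hu', rfl⟩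
    · rw [hu u ⟨hu', by simpa using hht⟩]
    · simp at hht
  · obtain ⟨s, ⟨hs, hh⟩, hu⟩ := hB h
    refine ⟨s.map Function.Embedding.inr, ⟨mem_sumBlocks.2 (Or.inr ⟨s, hs, rfl⟩), by simpa⟩, ?_⟩
    rintro t ⟨ht, hht⟩
    rcases mem_sumBlocks.1 ht with ⟨u, hu', rfl⟩ | ⟨u, hu', rfl⟩
    · simp at hht
    · rw [hu u ⟨hu', by simpa using hht⟩]

/-- Nonemptiness is essential: the empty set has the same image from either side, so its origin
could not be recovered. -/
theorem map_inl_mem_sumBlocks {A : Finset (Finset K)} {B : Finset (Finset L)} {s : Finset K}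
    (hs : s.Nonempty) : s.map Function.Embedding.inl ∈ sumBlocks A B ↔ s ∈ A := by
  rw [mem_sumBlocks]
  constructor
  · rintro (⟨t, ht, h⟩ | ⟨t, ht, h⟩)
    · rwa [← Finset.map_injective _ h]
    · obtain ⟨x, hx⟩ := hs
      have : Sum.inl x ∈ t.map (Function.Embedding.inr : L ↪ K ⊕ L) := by
        rw [h]; simpa using hx
      simp at this
  · exact fun h => Or.inl ⟨s, h, rfl⟩

theorem map_inr_mem_sumBlocks {A : Finset (Finset K)} {B : Finset (Finset L)} {s : Finset L}
    (hs : s.Nonempty) : s.map Function.Embedding.inr ∈ sumBlocks A B ↔ s ∈ B := by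
  rw [mem_sumBlocks]
  constructor
  · rintro (⟨t, ht, h⟩ | ⟨t, ht, h⟩)
    · obtain ⟨x, hx⟩ := hs
      have : Sum.inr x ∈ t.map (Function.Embedding.inl : K ↪ K ⊕ L) := by
        rw [h]; simpa using hx
      simp at this
    · rwa [← Finset.map_injective _ h]
  · exact fun h => Or.inr ⟨s, h, rfl⟩

theorem prod_sumBlocks {A : Finset (Finset K)} {B : Finset (Finset L)}
    (hA : ∀ s ∈ A, s.Nonempty) (f : Finset (K ⊕ L) → ℝ) :
    ∏ s ∈ sumBlocks A B, f s = (∏ s ∈ A, f (s.map Function.Embedding.inl)) *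
      ∏ s ∈ B, f (s.map Function.Embedding.inr) := by
  classical
  rw [sumBlocks, Finset.prod_union, Finset.prod_map, Finset.prod_map]
  · rfl
  · rw [Finset.disjoint_left]
    intro s hs hs'
    obtain ⟨t, ht, rfl⟩ := Finset.mem_map.1 hs
    obtain ⟨u, hu, h⟩ := Finset.mem_map.1 hs'
    obtain ⟨x, hx⟩ := hA t ht
    have : Sum.inl x ∈ u.map (Function.Embedding.inr : L ↪ K ⊕ L) := by
      change u.map _ = t.map _ at h
      rw [h]; simpa using hx
    simp at this

/-- The members of a set of subsets which lie on the left. -/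
noncomputable def leftBlocks (C : Finset (Finset (K ⊕ L))) : Finset (Finset K) :=
  C.preimage (Finset.map Function.Embedding.inl) (Finset.map_injective _).injOn

/-- The members of a set of subsets which lie on the right. -/
noncomputable def rightBlocks (C : Finset (Finset (K ⊕ L))) : Finset (Finset L) :=
  C.preimage (Finset.map Function.Embedding.inr) (Finset.map_injective _).injOn

theorem mem_leftBlocks {C : Finset (Finset (K ⊕ L))} {s : Finset K} :
    s ∈ leftBlocks C ↔ s.map Function.Embedding.inl ∈ C := Finset.mem_preimage

theorem mem_rightBlocks {C : Finset (Finset (K ⊕ L))} {s : Finset L} :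
    s ∈ rightBlocks C ↔ s.map Function.Embedding.inr ∈ C := Finset.mem_preimage

theorem exists_map_inl_eq {s : Finset (K ⊕ L)} (h : ∀ x ∈ s, x.isLeft) :
    ∃ t : Finset K, t.map Function.Embedding.inl = s := by
  refine ⟨s.toLeft, ?_⟩
  ext (x | x)
  · simp
  · simpa using fun hx => by simpa using h _ hx

theorem exists_map_inr_eq {s : Finset (K ⊕ L)} (h : ∀ x ∈ s, x.isRight) :
    ∃ t : Finset L, t.map Function.Embedding.inr = s := by
  refine ⟨s.toRight, ?_⟩
  ext (x | x)
  · simpa using fun hx => by simpa using h _ hx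
  · simp

theorem existsUnique_mem_leftBlocks {C : Finset (Finset (K ⊕ L))}
    (hC : ∀ h : K ⊕ L, ∃! s, s ∈ C ∧ h ∈ s)
    (hsplit : ∀ s ∈ C, ∀ x ∈ s, ∀ y ∈ s, x.isLeft → y.isLeft) :
    ∀ h : K, ∃! s, s ∈ leftBlocks C ∧ h ∈ s := by
  intro h
  obtain ⟨s, ⟨hs, hh⟩, hu⟩ := hC (Sum.inl h)
  obtain ⟨t, rfl⟩ := exists_map_inl_eq fun x hx => hsplit s hs _ hh x hx rfl
  refine ⟨t, ⟨mem_leftBlocks.2 hs, by simpa using hh⟩, ?_⟩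
  rintro u ⟨hu1, hu2⟩
  exact Finset.map_injective _ (hu _ ⟨mem_leftBlocks.1 hu1, by simpa using hu2⟩)

theorem existsUnique_mem_rightBlocks {C : Finset (Finset (K ⊕ L))}
    (hC : ∀ h : K ⊕ L, ∃! s, s ∈ C ∧ h ∈ s)
    (hsplit : ∀ s ∈ C, ∀ x ∈ s, ∀ y ∈ s, x.isLeft → y.isLeft) :
    ∀ h : L, ∃! s, s ∈ rightBlocks C ∧ h ∈ s := by
  intro h
  obtain ⟨s, ⟨hs, hh⟩, hu⟩ := hC (Sum.inr h)
  obtain ⟨t, rfl⟩ := exists_map_inr_eq (s := s) fun x hx => by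
    rw [← Sum.not_isLeft]
    simpa using mt (hsplit s hs x hx _ hh) (by simp)
  refine ⟨t, ⟨mem_rightBlocks.2 hs, by simpa using hh⟩, ?_⟩
  rintro u ⟨hu1, hu2⟩
  exact Finset.map_injective _ (hu _ ⟨mem_rightBlocks.1 hu1, by simpa using hu2⟩)

theorem sumBlocks_left_right {C : Finset (Finset (K ⊕ L))}
    (hsplit : ∀ s ∈ C, ∀ x ∈ s, ∀ y ∈ s, x.isLeft → y.isLeft) :
    sumBlocks (leftBlocks C) (rightBlocks C) = C := by
  ext s
  rw [mem_sumBlocks]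
  constructor
  · rintro (⟨t, ht, rfl⟩ | ⟨t, ht, rfl⟩)
    · exact mem_leftBlocks.1 ht
    · exact mem_rightBlocks.1 ht
  · intro hs
    by_cases h : ∃ x ∈ s, x.isLeft
    · obtain ⟨x, hx, hl⟩ := h
      obtain ⟨t, rfl⟩ := exists_map_inl_eq fun y hy => hsplit s hs x hx y hy hl
      exact Or.inl ⟨t, mem_leftBlocks.2 hs, rfl⟩
    · obtain ⟨t, rfl⟩ := exists_map_inr_eq (s := s) fun y hy => by
        rw [← Sum.not_isLeft]
        simpa using fun hl => h ⟨y, hy, hl⟩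
      exact Or.inr ⟨t, mem_rightBlocks.2 hs, rfl⟩

end Blocks

namespace TrivalentGraph

variable {H K L : Type*}

/-- The disjoint union of two trivalent graphs. -/
noncomputable def sum (Γ₁ : TrivalentGraph K) (Γ₂ : TrivalentGraph L) :
    TrivalentGraph (K ⊕ L) where
  edges := sumBlocks Γ₁.edges Γ₂.edges
  vertices := sumBlocks Γ₁.vertices Γ₂.vertices
  card_of_mem_edges := card_of_mem_sumBlocks Γ₁.card_of_mem_edges Γ₂.card_of_mem_edges
  card_of_mem_vertices := card_of_mem_sumBlocks Γ₁.card_of_mem_vertices Γ₂.card_of_mem_vertices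
  existsUnique_edge := existsUnique_mem_sumBlocks Γ₁.existsUnique_edge Γ₂.existsUnique_edge
  existsUnique_vertex := existsUnique_mem_sumBlocks Γ₁.existsUnique_vertex Γ₂.existsUnique_vertex

theorem nonempty_of_mem_edges (Γ : TrivalentGraph H) : ∀ s ∈ Γ.edges, s.Nonempty := by
  intro s hs
  rw [← Finset.card_pos, Γ.card_of_mem_edges s hs]
  norm_num

theorem nonempty_of_mem_vertices (Γ : TrivalentGraph H) : ∀ s ∈ Γ.vertices, s.Nonempty := by
  intro s hs
  rw [← Finset.card_pos, Γ.card_of_mem_vertices s hs]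
  norm_num

theorem sum_injective {Γ₁ Γ₁' : TrivalentGraph K} {Γ₂ Γ₂' : TrivalentGraph L}
    (h : Γ₁.sum Γ₂ = Γ₁'.sum Γ₂') : Γ₁ = Γ₁' ∧ Γ₂ = Γ₂' := by
  have he : sumBlocks Γ₁.edges Γ₂.edges = sumBlocks Γ₁'.edges Γ₂'.edges := congrArg edges h
  have hv : sumBlocks Γ₁.vertices Γ₂.vertices = sumBlocks Γ₁'.vertices Γ₂'.vertices :=
    congrArg vertices h
  have key : ∀ {A A' : Finset (Finset K)} {B B' : Finset (Finset L)},
      (∀ s ∈ A, s.Nonempty) → (∀ s ∈ A', s.Nonempty) → (∀ s ∈ B, s.Nonempty) →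
      (∀ s ∈ B', s.Nonempty) → sumBlocks A B = sumBlocks A' B' → A = A' ∧ B = B' := by
    intro A A' B B' hA hA' hB hB' hs
    constructor
    · ext s
      rcases s.eq_empty_or_nonempty with rfl | hne
      · exact ⟨fun h => absurd (hA _ h) (by simp), fun h => absurd (hA' _ h) (by simp)⟩
      · rw [← map_inl_mem_sumBlocks (B := B) hne, hs, map_inl_mem_sumBlocks hne]
    · ext s
      rcases s.eq_empty_or_nonempty with rfl | hne
      · exact ⟨fun h => absurd (hB _ h) (by simp), fun h => absurd (hB' _ h) (by simp)⟩
      · rw [← map_inr_mem_sumBlocks (A := A) hne, hs, map_inr_mem_sumBlocks hne]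
  have h1 := key Γ₁.nonempty_of_mem_edges Γ₁'.nonempty_of_mem_edges
    Γ₂.nonempty_of_mem_edges Γ₂'.nonempty_of_mem_edges he
  have h2 := key Γ₁.nonempty_of_mem_vertices Γ₁'.nonempty_of_mem_vertices
    Γ₂.nonempty_of_mem_vertices Γ₂'.nonempty_of_mem_vertices hv
  exact ⟨ext_edges_vertices h1.1 h2.1, ext_edges_vertices h1.2 h2.2⟩

/-- If no block containing a left half-edge reaches the right side, every block lies on one side,
and the two sides are themselves graphs. -/
theorem exists_sum_eq (Γ : TrivalentGraph (K ⊕ L))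
    (hsplit : ∀ s, s ∈ Γ.edges ∨ s ∈ Γ.vertices → ∀ x ∈ s, ∀ y ∈ s, x.isLeft → y.isLeft) :
    ∃ (Γ₁ : TrivalentGraph K) (Γ₂ : TrivalentGraph L), Γ₁.sum Γ₂ = Γ := by
  refine ⟨⟨leftBlocks Γ.edges, leftBlocks Γ.vertices, fun s hs => ?_, fun s hs => ?_, ?_, ?_⟩,
    ⟨rightBlocks Γ.edges, rightBlocks Γ.vertices, fun s hs => ?_, fun s hs => ?_, ?_, ?_⟩, ?_⟩
  · exact (Finset.card_map _).symm.trans (Γ.card_of_mem_edges _ (mem_leftBlocks.1 hs))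
  · exact (Finset.card_map _).symm.trans (Γ.card_of_mem_vertices _ (mem_leftBlocks.1 hs))
  · exact existsUnique_mem_leftBlocks Γ.existsUnique_edge fun s hs => hsplit s (Or.inl hs)
  · exact existsUnique_mem_leftBlocks Γ.existsUnique_vertex fun s hs => hsplit s (Or.inr hs)
  · exact (Finset.card_map _).symm.trans (Γ.card_of_mem_edges _ (mem_rightBlocks.1 hs))
  · exact (Finset.card_map _).symm.trans (Γ.card_of_mem_vertices _ (mem_rightBlocks.1 hs))
  · exact existsUnique_mem_rightBlocks Γ.existsUnique_edge fun s hs => hsplit s (Or.inl hs)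
  · exact existsUnique_mem_rightBlocks Γ.existsUnique_vertex fun s hs => hsplit s (Or.inr hs)
  · exact ext_edges_vertices (sumBlocks_left_right fun s hs => hsplit s (Or.inl hs))
      (sumBlocks_left_right fun s hs => hsplit s (Or.inr hs))

/-- Two half-edges are joined by a chain of edges and vertices. -/
def Joined (Γ : TrivalentGraph H) : H → H → Prop :=
  Relation.ReflTransGen
    (fun x y => ∃ s : Finset H, (s ∈ Γ.edges ∨ s ∈ Γ.vertices) ∧ x ∈ s ∧ y ∈ s)

theorem Joined.symm {Γ : TrivalentGraph H} {a b : H} (h : Γ.Joined a b) : Γ.Joined b a := by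
  induction h with
  | refl => exact .refl
  | tail _ hstep ih =>
    obtain ⟨s, hs, hx, hy⟩ := hstep
    exact ih.head ⟨s, hs, hy, hx⟩

theorem IsIso.joined {Γ : TrivalentGraph H} {Δ : TrivalentGraph K} {σ : H ≃ K}
    (h : Γ.IsIso Δ σ) {a b : H} (hab : Γ.Joined a b) : Δ.Joined (σ a) (σ b) := by
  refine Relation.ReflTransGen.lift σ ?_ _ _ hab
  rintro p q ⟨s, hs, hp, hq⟩
  exact ⟨s.map σ.toEmbedding, hs.imp (h.1 s).1 (h.2 s).1, by simpa using hp, by simpa using hq⟩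

theorem IsIso.joined_iff {Γ : TrivalentGraph H} {Δ : TrivalentGraph K} {σ : H ≃ K}
    (h : Γ.IsIso Δ σ) {a b : H} : Δ.Joined (σ a) (σ b) ↔ Γ.Joined a b :=
  ⟨fun hab => by simpa using h.symm.joined hab, h.joined⟩

/-- No block of a disjoint union meets both sides, so a chain starting on the left stays there. -/
theorem joined_sum_inl {Γ₁ : TrivalentGraph K} {Γ₂ : TrivalentGraph L} {a : K} {y : K ⊕ L} :
    (Γ₁.sum Γ₂).Joined (Sum.inl a) y ↔ ∃ b, y = Sum.inl b ∧ Γ₁.Joined a b := by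
  constructor
  · intro h
    induction h with
    | refl => exact ⟨a, rfl, .refl⟩
    | tail _ hstep ih =>
      obtain ⟨b, rfl, hb⟩ := ih
      obtain ⟨s, hs, h1, h2⟩ := hstep
      have key : ∀ {A : Finset (Finset K)} {B : Finset (Finset L)}, s ∈ sumBlocks A B →
          ∃ t ∈ A, t.map Function.Embedding.inl = s := by
        intro A B hs
        rcases mem_sumBlocks.1 hs with h | ⟨t, ht, rfl⟩
        · exact h
        · simp at h1
      have : ∃ t, (t ∈ Γ₁.edges ∨ t ∈ Γ₁.vertices) ∧ t.map Function.Embedding.inl = s := by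
        rcases hs with hs | hs
        · obtain ⟨t, ht, h⟩ := key hs
          exact ⟨t, Or.inl ht, h⟩
        · obtain ⟨t, ht, h⟩ := key hs
          exact ⟨t, Or.inr ht, h⟩
      obtain ⟨t, ht, rfl⟩ := this
      obtain ⟨c, hc, rfl⟩ := Finset.mem_map.1 h2
      exact ⟨c, rfl, hb.tail ⟨t, ht, by simpa using h1, hc⟩⟩
  · rintro ⟨b, rfl, hb⟩
    refine Relation.ReflTransGen.lift Sum.inl ?_ _ _ hb
    rintro p q ⟨s, hs, hp, hq⟩
    exact ⟨s.map Function.Embedding.inl, hs.imp (fun h => mem_sumBlocks.2 (Or.inl ⟨s, h, rfl⟩))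
      (fun h => mem_sumBlocks.2 (Or.inl ⟨s, h, rfl⟩)), by simpa using hp, by simpa using hq⟩

/-- The left summand is the component of a half-edge if and only if the graph is the disjoint
union of a connected graph on the left and a graph on the right. -/
theorem joined_iff_isLeft_iff (Γ : TrivalentGraph (K ⊕ L)) (x : K ⊕ L) :
    (∀ y, Γ.Joined x y ↔ y.isLeft) ↔ x.isLeft ∧
      ∃ (Γ₁ : TrivalentGraph K) (Γ₂ : TrivalentGraph L), Γ₁.Connected ∧ Γ₁.sum Γ₂ = Γ := by
  constructor
  · intro h
    have hx : x.isLeft := (h x).1 .refl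
    refine ⟨hx, ?_⟩
    obtain ⟨Γ₁, Γ₂, rfl⟩ := Γ.exists_sum_eq fun s hs a ha b hb hal =>
      (h b).1 (((h a).2 hal).tail ⟨s, hs, ha, hb⟩)
    obtain ⟨k, rfl⟩ := Sum.isLeft_iff.1 hx
    refine ⟨Γ₁, Γ₂, ⟨⟨k⟩, fun a b => ?_⟩, rfl⟩
    have h1 := ((h (Sum.inl a)).2 rfl).symm.trans ((h (Sum.inl b)).2 rfl)
    obtain ⟨c, hc, hac⟩ := joined_sum_inl.1 h1
    obtain rfl := Sum.inl_injective hc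
    exact hac
  · rintro ⟨hx, Γ₁, Γ₂, hc, rfl⟩ y
    obtain ⟨k, rfl⟩ := Sum.isLeft_iff.1 hx
    rw [joined_sum_inl]
    constructor
    · rintro ⟨b, rfl, -⟩
      rfl
    · intro hy
      obtain ⟨b, rfl⟩ := Sum.isLeft_iff.1 hy
      exact ⟨b, rfl, hc.2 k b⟩

/-- A labeling of a disjoint union is a pair of labelings, and each block sees only one of them. -/
theorem weight_sum [Fintype K] [DecidableEq K] [Fintype L] [DecidableEq L] {N : ℕ}
    (Q : LinearMap.BilinForm ℝ (Fin N → ℝ))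
    (V : MultilinearMap ℝ (fun _ : Fin 3 => Fin N → ℝ) ℝ)
    (Γ₁ : TrivalentGraph K) (Γ₂ : TrivalentGraph L) :
    (Γ₁.sum Γ₂).weight Q V = Γ₁.weight Q V * Γ₂.weight Q V := by
  unfold weight
  rw [Finset.sum_mul_sum, ← Fintype.sum_prod_type']
  refine Fintype.sum_equiv (Equiv.sumArrowEquivProdArrow K L (Fin N)) _ _ fun l => ?_
  simp only [sum]
  rw [prod_sumBlocks Γ₁.nonempty_of_mem_vertices, prod_sumBlocks Γ₁.nonempty_of_mem_edges]
  simp only [Finset.map_val, Multiset.map_map]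
  rw [mul_mul_mul_comm]
  rfl

end TrivalentGraph

/-! ### The exponential formula -/

section Exponential

variable {N : ℕ} (Q : LinearMap.BilinForm ℝ (Fin N → ℝ))
  (V : MultilinearMap ℝ (fun _ : Fin 3 => Fin N → ℝ) ℝ)

-- Only marked half-edges on the left contribute, all by the same amount, whence the factor |K|. The
-- contributing graphs are uniquely a connected graph on the left plus an arbitrary one on the
-- right.
open Classical in
theorem sum_component_left (K L : Type*) [Fintype K] [DecidableEq K] [Fintype L] [DecidableEq L] :
    ∑ Γ : TrivalentGraph (K ⊕ L), ∑ x : K ⊕ L,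
      (if ∀ y, Γ.Joined x y ↔ y.isLeft then Γ.weight Q V else 0) =
      Fintype.card K * connectedTotalWeight Q V K * totalWeight Q V L := by
  simp only [TrivalentGraph.joined_iff_isLeft_iff, Fintype.sum_sum_type, Sum.isLeft_inl,
    Sum.isLeft_inr, true_and, Bool.false_eq_true, false_and, if_false, Finset.sum_const_zero,
    add_zero, Finset.sum_const, Finset.card_univ, nsmul_eq_mul]
  rw [← Finset.mul_sum, mul_assoc, ← Finset.sum_filter]
  congr 1
  rw [connectedTotalWeight, totalWeight, Finset.sum_mul_sum, ← Finset.sum_product']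
  symm
  refine Finset.sum_bij (fun p _ => p.1.sum p.2) ?_ ?_ ?_ ?_
  · intro p hp
    simp only [Finset.mem_product, Finset.mem_filter, Finset.mem_univ, true_and, and_true] at hp
    simpa using ⟨p.1, hp, p.2, rfl⟩
  · intro p _ q _ hpq
    exact Prod.ext_iff.2 (TrivalentGraph.sum_injective hpq)
  · intro Γ hΓ
    obtain ⟨Γ₁, Γ₂, hc, rfl⟩ := (Finset.mem_filter.1 hΓ).2
    exact ⟨(Γ₁, Γ₂), by simpa using hc, rfl⟩
  · intro p _
    exact (TrivalentGraph.weight_sum Q V p.1 p.2).symm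

/-- Marking a half-edge and splitting off its component. -/
theorem card_mul_totalWeight (H : Type*) [Fintype H] [DecidableEq H] :
    Fintype.card H * totalWeight Q V H = ∑ S : Finset H,
      Fintype.card {h // h ∈ S} * connectedTotalWeight Q V {h // h ∈ S} *
        totalWeight Q V {h // h ∉ S} := by
  classical
  have h1 : ∀ S : Finset H, Fintype.card {h // h ∈ S} * connectedTotalWeight Q V {h // h ∈ S} *
        totalWeight Q V {h // h ∉ S} = ∑ Γ : TrivalentGraph H, ∑ x : H,
      (if ∀ y, Γ.Joined x y ↔ y ∈ S then Γ.weight Q V else 0) := by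
    intro S
    rw [← sum_component_left]
    refine Fintype.sum_equiv (TrivalentGraph.relabelEquiv (Equiv.sumCompl (· ∈ S))) _ _ fun Γ => ?_
    refine Fintype.sum_equiv (Equiv.sumCompl (· ∈ S)) _ _ fun x => ?_
    have hiso := Γ.isIso_relabel (Equiv.sumCompl (· ∈ S))
    have hcond : (∀ y, Γ.Joined x y ↔ y.isLeft) ↔
        ∀ y, (Γ.relabel (Equiv.sumCompl (· ∈ S))).Joined (Equiv.sumCompl (· ∈ S) x) y ↔ y ∈ S := by
      rw [← (Equiv.sumCompl (· ∈ S)).forall_congr_right]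
      refine forall_congr' fun y => ?_
      rw [hiso.joined_iff]
      have : Equiv.sumCompl (· ∈ S) y ∈ S ↔ y.isLeft := by
        rcases y with y | y
        · simp
        · simpa using y.2
      rw [this]
    simp only [hcond]
    rw [hiso.weight_eq Q V]
    rfl
  simp only [h1]
  rw [Finset.sum_comm, totalWeight, Finset.mul_sum]
  refine Finset.sum_congr rfl fun Γ _ => ?_
  rw [Finset.sum_comm, ← nsmul_eq_mul, ← Finset.card_univ, ← Finset.sum_const]
  refine Finset.sum_congr rfl fun x _ => ?_
  -- For given Γ and x, exactly one `S` is the component of x, so summing over `S` counts each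
  -- marked graph once.
  rw [Finset.sum_eq_single (Finset.univ.filter fun y => Γ.Joined x y)]
  · simp
  · intro S _ hS
    rw [if_neg]
    intro h
    exact hS (by ext y; simp [h])
  · simp

/-- Total weights depend only on the number of half-edges, so subsets of equal size contribute
equally and a binomial coefficient appears. -/
theorem mul_totalWeight_fin (n : ℕ) :
    n * totalWeight Q V (Fin n) = ∑ k ∈ Finset.range (n + 1),
      n.choose k * (k * connectedTotalWeight Q V (Fin k) * totalWeight Q V (Fin (n - k))) := by
  have h := card_mul_totalWeight Q V (Fin n)
  rw [Fintype.card_fin] at h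
  rw [h, ← Finset.powerset_univ]
  have h1 : ∀ S : Finset (Fin n), (Fintype.card {h // h ∈ S} *
      connectedTotalWeight Q V {h // h ∈ S} * totalWeight Q V {h // h ∉ S} : ℝ) =
      (fun k : ℕ => (k * connectedTotalWeight Q V (Fin k) * totalWeight Q V (Fin (n - k)) : ℝ))
        S.card := by
    intro S
    have hS : Fintype.card {h // h ∈ S} = S.card := Fintype.card_coe S
    have hS' : Fintype.card {h // h ∉ S} = n - S.card := by
      rw [Fintype.card_subtype_compl, Fintype.card_fin, hS]
    rw [connectedTotalWeight_congr Q V (Fintype.equivFinOfCardEq hS),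
      totalWeight_congr Q V (Fintype.equivFinOfCardEq hS'), hS]
  refine (Finset.sum_congr rfl fun S _ => h1 S).trans
    ((Finset.sum_powerset_apply_card (fun k : ℕ =>
      (k * connectedTotalWeight Q V (Fin k) * totalWeight Q V (Fin (n - k)) : ℝ))).trans ?_)
  rw [Finset.card_univ, Fintype.card_fin]
  simp only [nsmul_eq_mul]

/-- The exponential formula, in the form of a recursion. -/
theorem mul_graphSum (m : ℕ) :
    m * graphSum Q V m = ∑ k ∈ Finset.range (m + 1),
      k * connectedGraphSum Q V k * graphSum Q V (m - k) := by
  have h := mul_totalWeight_fin Q V (6 * m)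
  have hinj : Function.Injective fun k : ℕ => 6 * k := fun a b hab => by
    simpa using hab
  -- Only component sizes divisible by 6 survive, since the number of half-edges of a trivalent
  -- graph is divisible by both 2 and 3.
  have hsub : (Finset.range (m + 1)).map ⟨_, hinj⟩ ⊆ Finset.range (6 * m + 1) := by
    intro j hj
    obtain ⟨k, hk, rfl⟩ := Finset.mem_map.1 hj
    simp only [Finset.mem_range, Function.Embedding.coeFn_mk] at hk ⊢
    omega
  rw [← Finset.sum_subset hsub, Finset.sum_map] at h
  · have hfac : ∀ k ∈ Finset.range (m + 1), ((6 * m).choose (6 * k) *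
        ((6 * k : ℕ) * connectedTotalWeight Q V (Fin (6 * k)) *
          totalWeight Q V (Fin (6 * m - 6 * k))) : ℝ) =
        6 * (6 * m).factorial * (k * connectedGraphSum Q V k * graphSum Q V (m - k)) := by
      intro k hk
      have hk' : k ≤ m := Nat.lt_succ_iff.1 (Finset.mem_range.1 hk)
      have hc : ((6 * m).choose (6 * k) * (6 * k).factorial * (6 * m - 6 * k).factorial : ℝ) =
          (6 * m).factorial := by
        exact_mod_cast Nat.choose_mul_factorial_mul_factorial (show 6 * k ≤ 6 * m by omega)
      rw [← hc, ← Nat.mul_sub, totalWeight_fin, connectedTotalWeight_fin]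
      push_cast
      ring
    have h2 := Finset.sum_congr rfl hfac
    simp only [Function.Embedding.coeFn_mk] at h
    rw [h2, ← Finset.mul_sum, totalWeight_fin] at h
    have hpos : (0 : ℝ) < 6 * (6 * m).factorial := by positivity
    refine mul_left_cancel₀ hpos.ne' ?_
    rw [← h]
    push_cast
    ring
  · intro j _ hj
    have hdvd : ¬ 6 ∣ j := by
      rintro ⟨k, rfl⟩
      refine hj (Finset.mem_map.2 ⟨k, ?_, rfl⟩)
      simp only [Finset.mem_range] at *
      omega
    rw [connectedTotalWeight_eq_zero Q V (by simpa using hdvd)]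
    simp

end Exponential

/-! ### Wick's theorem -/

section Wick

variable {H : Type*} [Fintype H] [DecidableEq H]

open Classical in
/-- The partitions of a set of half-edges into pairs. -/
noncomputable def pairings (S : Finset H) : Finset (Finset (Finset H)) :=
  Finset.univ.filter fun E => (∀ e ∈ E, e.card = 2 ∧ e ⊆ S) ∧ ∀ h ∈ S, ∃! e, e ∈ E ∧ h ∈ e

theorem mem_pairings {S : Finset H} {E : Finset (Finset H)} :
    E ∈ pairings S ↔ (∀ e ∈ E, e.card = 2 ∧ e ⊆ S) ∧ ∀ h ∈ S, ∃! e, e ∈ E ∧ h ∈ e := by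
  simp [pairings]

theorem pairings_empty : pairings (∅ : Finset H) = {∅} := by
  ext E
  rw [mem_pairings, Finset.mem_singleton]
  constructor
  · rintro ⟨h, -⟩
    refine Finset.eq_empty_of_forall_notMem fun e he => ?_
    obtain ⟨h1, h2⟩ := h e he
    rw [Finset.subset_empty.1 h2] at h1
    simp at h1
  · rintro rfl
    simp

theorem insert_mem_pairings {S : Finset H} {a b : H} (ha : a ∈ S) (hb : b ∈ S.erase a)
    {E : Finset (Finset H)} (hE : E ∈ pairings ((S.erase a).erase b)) :
    insert {a, b} E ∈ pairings S := by
  obtain ⟨hb1, hb2⟩ := Finset.mem_erase.1 hb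
  rw [mem_pairings] at hE ⊢
  obtain ⟨h1, h2⟩ := hE
  have hnot : ∀ e ∈ E, a ∉ e ∧ b ∉ e := by
    intro e he
    exact ⟨fun h => by simpa using (h1 e he).2 h, fun h => by simpa using (h1 e he).2 h⟩
  constructor
  · intro e he
    rcases Finset.mem_insert.1 he with rfl | he
    · refine ⟨Finset.card_pair (Ne.symm hb1), ?_⟩
      intro x hx
      rcases Finset.mem_insert.1 hx with rfl | hx
      · exact ha
      · rwa [Finset.mem_singleton.1 hx]
    · exact ⟨(h1 e he).1, (h1 e he).2.trans
        ((Finset.erase_subset _ _).trans (Finset.erase_subset _ _))⟩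
  · intro x hx
    by_cases hxab : x ∈ ({a, b} : Finset H)
    · refine ⟨{a, b}, ⟨Finset.mem_insert_self _ _, hxab⟩, ?_⟩
      rintro f ⟨hf, hxf⟩
      rcases Finset.mem_insert.1 hf with rfl | hf'
      · rfl
      · rcases Finset.mem_insert.1 hxab with hxa | hxb
        · rw [hxa] at hxf
          exact absurd hxf (hnot f hf').1
        · rw [Finset.mem_singleton.1 hxb] at hxf
          exact absurd hxf (hnot f hf').2
    · have hx' : x ∈ (S.erase a).erase b := by
        simp only [Finset.mem_insert, Finset.mem_singleton, not_or] at hxab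
        simp [hxab, hx]
      obtain ⟨f, ⟨hf, hxf⟩, hu⟩ := h2 x hx'
      refine ⟨f, ⟨Finset.mem_insert_of_mem hf, hxf⟩, ?_⟩
      rintro g ⟨hg, hxg⟩
      rcases Finset.mem_insert.1 hg with rfl | hg
      · exact absurd hxg hxab
      · exact hu g ⟨hg, hxg⟩

theorem pair_notMem_of_mem_pairings {S : Finset H} {a b c : H} {E : Finset (Finset H)}
    (hE : E ∈ pairings ((S.erase a).erase b)) : ({a, c} : Finset H) ∉ E := by
  intro h
  have := ((mem_pairings.1 hE).1 _ h).2 (Finset.mem_insert_self a {c})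
  simp at this

theorem exists_eq_insert_of_mem_pairings {S : Finset H} {a : H} (ha : a ∈ S)
    {E : Finset (Finset H)} (hE : E ∈ pairings S) :
    ∃ b ∈ S.erase a, ∃ F ∈ pairings ((S.erase a).erase b), insert {a, b} F = E := by
  obtain ⟨h1, h2⟩ := mem_pairings.1 hE
  obtain ⟨e, ⟨he, hae⟩, -⟩ := h2 a ha
  obtain ⟨b, hab, rfl⟩ : ∃ b, b ≠ a ∧ e = {a, b} := by
    obtain ⟨x, y, hxy, rfl⟩ := Finset.card_eq_two.1 (h1 e he).1
    rcases Finset.mem_insert.1 hae with rfl | h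
    · exact ⟨y, hxy.symm, rfl⟩
    · rw [Finset.mem_singleton] at h
      subst h
      exact ⟨x, hxy, Finset.pair_comm _ _⟩
  have hbS : b ∈ S := (h1 _ he).2 (by simp)
  refine ⟨b, Finset.mem_erase.2 ⟨hab, hbS⟩, E.erase {a, b}, ?_, Finset.insert_erase he⟩
  rw [mem_pairings]
  constructor
  · intro f hf
    obtain ⟨hne, hfE⟩ := Finset.mem_erase.1 hf
    refine ⟨(h1 f hfE).1, fun x hx => ?_⟩
    have hxS := (h1 f hfE).2 hx
    have hxab : x ∉ ({a, b} : Finset H) := fun h =>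
      hne ((h2 x hxS).unique ⟨hfE, hx⟩ ⟨he, h⟩)
    simp only [Finset.mem_insert, Finset.mem_singleton, not_or] at hxab
    simp [hxab, hxS]
  · intro x hx
    simp only [Finset.mem_erase] at hx
    obtain ⟨f, ⟨hf, hxf⟩, hu⟩ := h2 x hx.2.2
    refine ⟨f, ⟨Finset.mem_erase.2 ⟨?_, hf⟩, hxf⟩,
      fun g hg => hu g ⟨(Finset.mem_erase.1 hg.1).2, hg.2⟩⟩
    rintro rfl
    simp [hx.1, hx.2.1] at hxf

/-- A pairing of `S` is given by the partner of a fixed element and a pairing of the rest. -/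
theorem sum_pairings_eq {S : Finset H} {a : H} (ha : a ∈ S) (w : Finset H → ℂ) :
    ∑ E ∈ pairings S, ∏ e ∈ E, w e = ∑ b ∈ S.erase a,
      w {a, b} * ∑ E ∈ pairings ((S.erase a).erase b), ∏ e ∈ E, w e := by
  simp only [Finset.mul_sum]
  rw [Finset.sum_sigma']
  symm
  refine Finset.sum_bij (fun p _ => insert {a, p.1} p.2) ?_ ?_ ?_ ?_
  · intro p hp
    rw [Finset.mem_sigma] at hp
    exact insert_mem_pairings ha hp.1 hp.2
  · rintro ⟨b, E⟩ hp ⟨c, F⟩ hq h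
    rw [Finset.mem_sigma] at hp hq
    simp only at hp hq h
    -- The partner of `a` can be read off the pairing, because no pair of the remainder contains
    -- `a`.
    have hbc : b = c := by
      have hb : ({a, b} : Finset H) ∈ insert {a, c} F := h ▸ Finset.mem_insert_self _ _
      rcases Finset.mem_insert.1 hb with hb | hb
      · have hb' : b ∈ ({a, c} : Finset H) := hb ▸ (by simp)
        rcases Finset.mem_insert.1 hb' with hba | hbc
        · exact absurd hba (Finset.mem_erase.1 hp.1).1
        · exact Finset.mem_singleton.1 hbc
      · exact absurd hb (pair_notMem_of_mem_pairings hq.2)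
    subst hbc
    have hEF : E = F := by
      rw [← Finset.erase_insert (pair_notMem_of_mem_pairings (c := b) hp.2), h,
        Finset.erase_insert (pair_notMem_of_mem_pairings (c := b) hq.2)]
    rw [hEF]
  · intro E hE
    obtain ⟨b, hb, F, hF, h⟩ := exists_eq_insert_of_mem_pairings ha hE
    exact ⟨⟨b, F⟩, Finset.mem_sigma.2 ⟨hb, hF⟩, h⟩
  · intro p hp
    rw [Finset.mem_sigma] at hp
    exact (Finset.prod_insert (pair_notMem_of_mem_pairings hp.2)).symm

theorem pderiv_prod_X {H : Type*} [DecidableEq H] {N : ℕ} (l : H → Fin N)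
    (S : Finset H) (j : Fin N) :
    MvPolynomial.pderiv j (∏ h ∈ S, MvPolynomial.X (l h) : MvPolynomial (Fin N) ℂ) =
      ∑ b ∈ S, if l b = j then ∏ h ∈ S.erase b, MvPolynomial.X (l h) else 0 := by
  induction S using Finset.induction_on with
  | empty => simp
  | insert a S ha ih =>
    rw [Finset.prod_insert ha, Derivation.leibniz, ih, Finset.sum_insert ha,
      Finset.erase_insert ha, MvPolynomial.pderiv_X, smul_eq_mul, smul_eq_mul, add_comm]
    congr 1
    · by_cases h : l a = j
      · subst h; simp
      · simp [h]
    · rw [Finset.mul_sum]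
      refine Finset.sum_congr rfl fun b hb => ?_
      have hab : a ≠ b := by
        rintro rfl
        exact ha hb
      rw [Finset.erase_insert_of_ne hab, Finset.prod_insert (by simp [ha])]
      split_ifs <;> simp

/-- Pulling out the variable at one half-edge a and differentiating the others pairs a with each
possible partner b, leaving the product over the rest. The sum over pairings obeys the same
recursion. -/
theorem wick {N : ℕ} (L : MvPolynomial (Fin N) ℂ →ₗ[ℂ] ℂ) (C : Fin N → Fin N → ℂ)
    (hL : ∀ k p, L (MvPolynomial.X k * p) = ∑ j, C k j * L (MvPolynomial.pderiv j p))
    (l : H → Fin N) (w : Finset H → ℂ) (hw : ∀ a b, a ≠ b → w {a, b} = C (l a) (l b))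
    (S : Finset H) :
    L (∏ h ∈ S, MvPolynomial.X (l h)) = L 1 * ∑ E ∈ pairings S, ∏ e ∈ E, w e := by
  induction S using Finset.strongInduction with
  | H S ih =>
    rcases S.eq_empty_or_nonempty with rfl | ⟨a, ha⟩
    · simp [pairings_empty]
    · rw [sum_pairings_eq ha, ← Finset.mul_prod_erase S _ ha, hL, Finset.mul_sum]
      simp only [pderiv_prod_X, map_sum, Finset.mul_sum]
      rw [Finset.sum_comm]
      refine Finset.sum_congr rfl fun b hb => ?_
      have hss : (S.erase a).erase b ⊂ S :=
        (Finset.erase_subset _ _).trans_ssubset (Finset.erase_ssubset ha)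
      -- Differentiating the factor at b is nonzero only in the direction j = l b, which selects the
      -- propagator C (l a) (l b).
      rw [Finset.sum_eq_single (l b)]
      · rw [if_pos rfl, ih _ hss, hw a b (Finset.mem_erase.1 hb).1.symm]
        simp only [Finset.mul_sum]
        exact Finset.sum_congr rfl fun E _ => by ring
      · intro j _ hj
        rw [if_neg (Ne.symm hj), map_zero, mul_zero]
      · simp

/-- Pairings are the same as trivalent graphs with prescribed vertices. -/
theorem sum_pairings_univ_eq {P : Finset (Finset H)} (hP : IsTriplePartition P)
    [DecidablePred fun Γ : TrivalentGraph H => Γ.vertices = P] (f : Finset (Finset H) → ℂ) :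
    ∑ E ∈ pairings Finset.univ, f E =
      ∑ Γ : TrivalentGraph H with Γ.vertices = P, f Γ.edges := by
  symm
  refine Finset.sum_bij (fun Γ _ => Γ.edges) ?_ ?_ ?_ ?_
  · intro Γ _
    exact mem_pairings.2 ⟨fun e he => ⟨Γ.card_of_mem_edges e he, Finset.subset_univ _⟩,
      fun h _ => Γ.existsUnique_edge h⟩
  · intro Γ hΓ Δ hΔ h
    exact TrivalentGraph.ext_edges_vertices h
      ((Finset.mem_filter.1 hΓ).2.trans (Finset.mem_filter.1 hΔ).2.symm)
  · intro E hE
    obtain ⟨h1, h2⟩ := mem_pairings.1 hE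
    exact ⟨⟨E, P, fun e he => (h1 e he).1, hP.card_eq, fun h => h2 h (Finset.mem_univ h),
      hP.existsUnique⟩, by simp, rfl⟩
  · intro _ _
    rfl

theorem pairings_univ_eq_empty (h : ¬ 2 ∣ Fintype.card H) :
    pairings (Finset.univ : Finset H) = ∅ := by
  refine Finset.eq_empty_of_forall_notMem fun E hE => h ?_
  obtain ⟨h1, h2⟩ := mem_pairings.1 hE
  have hU : E.biUnion id = Finset.univ := by
    ext h
    obtain ⟨v, ⟨hv, hh⟩, -⟩ := h2 h (Finset.mem_univ h)
    simpa using ⟨v, hv, hh⟩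
  have hd : (E : Set (Finset H)).PairwiseDisjoint id := by
    intro v hv w hw hvw
    refine Finset.disjoint_left.2 fun h h1 h3 => hvw ?_
    exact (h2 h (Finset.mem_univ h)).unique ⟨hv, h1⟩ ⟨hw, h3⟩
  rw [← Finset.card_univ, ← hU, Finset.card_biUnion hd]
  exact Finset.dvd_sum fun e he => by simp [(h1 e he).1]

end Wick

/-! ### The cubic terms -/

section Cubic

variable {N : ℕ} (Q : LinearMap.BilinForm ℝ (Fin N → ℝ))
  (V : MultilinearMap ℝ (fun _ : Fin 3 => Fin N → ℝ) ℝ)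

theorem cubicForm_eq_sum (x : Fin N → ℝ) :
    V (fun _ => x) = ∑ t : Fin 3 → Fin N, cubicComponents V t * ∏ r, x (t r) := by
  have h : (fun _ : Fin 3 => x) = fun _ => ∑ j, x j • (Pi.single j 1 : Fin N → ℝ) := by
    funext _
    conv_lhs => rw [← Finset.univ_sum_single x]
    exact Finset.sum_congr rfl fun j _ => by rw [← Pi.single_smul, smul_eq_mul, mul_one]
  rw [h, V.map_sum]
  refine Finset.sum_congr rfl fun t _ => ?_
  rw [V.map_smul_univ (fun r => x (t r)) fun r => Pi.single (t r) 1, smul_eq_mul, mul_comm]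
  rfl

/-- The power of a cubic form as a sum over labelings of half-edges. -/
theorem cubicForm_pow_eq_sum (j : ℕ) (x : Fin N → ℝ) :
    (V fun _ => x) ^ j = ∑ l : Fin j × Fin 3 → Fin N,
      (∏ i, cubicComponents V fun r => l (i, r)) * ∏ h, x (l h) := by
  rw [cubicForm_eq_sum, Fintype.sum_pow]
  refine Fintype.sum_equiv (Equiv.curry (Fin j) (Fin 3) (Fin N)).symm _ _ fun t => ?_
  rw [Finset.prod_mul_distrib, Fintype.prod_prod_type]
  rfl

/-- The polynomial of the `j`-th term of the expansion of the exponential at `k = 1`. -/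
noncomputable def cubicPolynomial (j : ℕ) : MvPolynomial (Fin N) ℂ :=
  MvPolynomial.C ((Complex.I / 6) ^ j / j.factorial) *
    ∑ l : Fin j × Fin 3 → Fin N,
      MvPolynomial.C (((∏ i, cubicComponents V fun r => l (i, r) : ℝ) : ℂ)) *
        ∏ h, MvPolynomial.X (l h)

theorem polyFun_cubicPolynomial (j : ℕ) (x : Fin N → ℝ) :
    polyFun (cubicPolynomial V j) x = cubicTerm V 1 j x := by
  have h := congrArg Complex.ofReal (cubicForm_pow_eq_sum V j x)
  have h2 : cubicTerm V 1 j x =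
      (Complex.I / 6) ^ j / j.factorial * (((V fun _ => x) ^ j : ℝ) : ℂ) := by
    simp only [cubicTerm]
    push_cast
    rw [div_pow, div_pow, mul_pow, mul_pow]
    ring
  rw [h2, h]
  simp [polyFun, cubicPolynomial]

/-- The partition of `Fin j × Fin 3` into the fibres of the first projection. -/
def fibrePartition (j : ℕ) : Finset (Finset (Fin j × Fin 3)) :=
  Finset.univ.image fun i => Finset.univ.map (Function.Embedding.sectR i (Fin 3))

theorem injective_fibre (j : ℕ) : Function.Injective fun i : Fin j =>
    (Finset.univ.map (Function.Embedding.sectR i (Fin 3)) : Finset (Fin j × Fin 3)) := by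
  intro a b h
  have : (a, (0 : Fin 3)) ∈ Finset.univ.map (Function.Embedding.sectR b (Fin 3)) := by
    have h' : (Finset.univ.map (Function.Embedding.sectR a (Fin 3)) : Finset (Fin j × Fin 3)) =
        Finset.univ.map (Function.Embedding.sectR b (Fin 3)) := h
    rw [← h']
    simp
  simpa [eq_comm] using this

theorem isTriplePartition_fibrePartition (j : ℕ) : IsTriplePartition (fibrePartition j) := by
  constructor
  · intro v hv
    obtain ⟨i, -, rfl⟩ := Finset.mem_image.1 hv
    simp
  · rintro ⟨i, r⟩
    refine ⟨Finset.univ.map (Function.Embedding.sectR i (Fin 3)),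
      ⟨Finset.mem_image_of_mem _ (Finset.mem_univ i), by simp⟩, ?_⟩
    rintro s ⟨hs, his⟩
    obtain ⟨i', -, rfl⟩ := Finset.mem_image.1 hs
    obtain ⟨r', -, h⟩ := Finset.mem_map.1 his
    have : i' = i := congrArg Prod.fst h
    rw [this]

theorem cubicComponents_perm
    (hV : ∀ (σ : Equiv.Perm (Fin 3)) (x : Fin 3 → Fin N → ℝ), V (fun r => x (σ r)) = V x)
    (σ : Equiv.Perm (Fin 3)) (t : Fin 3 → Fin N) :
    cubicComponents V (fun r => t (σ r)) = cubicComponents V t :=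
  hV σ fun r => Pi.single (t r) 1

theorem propagatorComponents_perm (hQs : ∀ x y, Q x y = Q y x) (σ : Equiv.Perm (Fin 2))
    (t : Fin 2 → Fin N) :
    propagatorComponents Q (fun r => t (σ r)) = propagatorComponents Q t := by
  have hsymm : (quadraticMatrix Q)⁻¹.transpose = (quadraticMatrix Q)⁻¹ := by
    rw [Matrix.transpose_nonsing_inv]
    congr 1
    ext j k
    exact hQs _ _
  have h01 : σ = 1 ∨ σ = Equiv.swap 0 1 := by
    revert σ
    decide
  rcases h01 with rfl | rfl
  · rfl
  · simp only [propagatorComponents, Equiv.swap_apply_left, Equiv.swap_apply_right]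
    conv_lhs => rw [← hsymm]
    rfl

/-- The half-edges must differ, but their labels may coincide; mapping the multiset keeps both
copies. -/
theorem evalMultiset_propagator (hQs : ∀ x y, Q x y = Q y x) {H : Type*} [DecidableEq H]
    (l : H → Fin N) {a b : H} (hab : a ≠ b) :
    evalMultiset (propagatorComponents Q) (({a, b} : Finset H).val.map l) =
      (quadraticMatrix Q)⁻¹ (l a) (l b) := by
  have h : ({a, b} : Finset H).val.map l = Finset.univ.val.map ![l a, l b] := by
    rw [Finset.insert_val_of_notMem (by simpa using hab)]
    rfl
  rw [h, evalMultiset_map _ (propagatorComponents_perm Q hQs)]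
  rfl

theorem prod_fibrePartition
    (hV : ∀ (σ : Equiv.Perm (Fin 3)) (x : Fin 3 → Fin N → ℝ), V (fun r => x (σ r)) = V x)
    (j : ℕ) (l : Fin j × Fin 3 → Fin N) :
    ∏ v ∈ fibrePartition j, evalMultiset (cubicComponents V) (v.val.map l) =
      ∏ i, cubicComponents V fun r => l (i, r) := by
  rw [fibrePartition, Finset.prod_image fun a _ b _ h => injective_fibre j h]
  refine Finset.prod_congr rfl fun i _ => ?_
  rw [Finset.map_val, Multiset.map_map, ← evalMultiset_map _ (cubicComponents_perm V hV)]
  rfl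

variable {Q V}

section Functional

variable {L : MvPolynomial (Fin N) ℂ →ₗ[ℂ] ℂ}

theorem functional_prod_X
    (hL : ∀ k p, L (MvPolynomial.X k * p) =
      ∑ j, Complex.I * (quadraticMatrix Q)⁻¹ k j * L (MvPolynomial.pderiv j p))
    (hQs : ∀ x y, Q x y = Q y x) {H : Type*} [Fintype H] [DecidableEq H]
    (l : H → Fin N) :
    L (∏ h, MvPolynomial.X (l h)) = L 1 * ∑ E ∈ pairings (Finset.univ : Finset H), ∏ e ∈ E,
      Complex.I * (evalMultiset (propagatorComponents Q) (e.val.map l) : ℝ) :=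
  wick L (fun j k => Complex.I * (quadraticMatrix Q)⁻¹ j k) hL l
    (fun e => Complex.I * (evalMultiset (propagatorComponents Q) (e.val.map l) : ℝ))
    (fun a b hab => by rw [evalMultiset_propagator Q hQs l hab]) Finset.univ

/-- An odd number of triples has an odd number of half-edges, which admits no pairing. -/
theorem functional_cubicPolynomial_odd
    (hL : ∀ k p, L (MvPolynomial.X k * p) =
      ∑ j, Complex.I * (quadraticMatrix Q)⁻¹ k j * L (MvPolynomial.pderiv j p))
    (hQs : ∀ x y, Q x y = Q y x) {j : ℕ} (hj : ¬ 2 ∣ j) :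
    L (cubicPolynomial V j) = 0 := by
  have h2 : ¬ 2 ∣ Fintype.card (Fin j × Fin 3) := by
    simp only [Fintype.card_prod, Fintype.card_fin]
    omega
  rw [cubicPolynomial, ← MvPolynomial.smul_eq_C_mul, map_smul, map_sum]
  simp only [← MvPolynomial.smul_eq_C_mul, map_smul, functional_prod_X hL hQs,
    pairings_univ_eq_empty h2, Finset.sum_empty, mul_zero, smul_zero, Finset.sum_const_zero]

/-- Wick's theorem on 6m half-edges produces the graphs with the fibres of the first projection as
vertices. Their weight sum is (2m)! 6^{2m} times the sum over classes, which cancels the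
denominators of the exponential series. -/
theorem functional_cubicPolynomial_even
    (hL : ∀ k p, L (MvPolynomial.X k * p) =
      ∑ j, Complex.I * (quadraticMatrix Q)⁻¹ k j * L (MvPolynomial.pderiv j p))
    (hQs : ∀ x y, Q x y = Q y x)
    (hV : ∀ (σ : Equiv.Perm (Fin 3)) (x : Fin 3 → Fin N → ℝ), V (fun r => x (σ r)) = V x)
    (m : ℕ) : L (cubicPolynomial V (2 * m)) = Complex.I ^ m * L 1 * graphSum Q V m := by
  classical
  have hcard : Fintype.card (Fin (2 * m) × Fin 3) = 6 * m := by
    simp only [Fintype.card_prod, Fintype.card_fin]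
    ring
  have hP := isTriplePartition_fibrePartition (2 * m)
  have hedges : ∀ Γ : TrivalentGraph (Fin (2 * m) × Fin 3), Γ.edges.card = 3 * m := by
    intro Γ
    have := Γ.card_halfEdges_eq_two_mul
    omega
  have hsum : ∑ l : Fin (2 * m) × Fin 3 → Fin N,
      ((∏ i, cubicComponents V fun r => l (i, r) : ℝ) : ℂ) * L (∏ h, MvPolynomial.X (l h)) =
      Complex.I ^ (3 * m) * L 1 *
        ((∑ Γ : TrivalentGraph (Fin (2 * m) × Fin 3) with Γ.vertices = fibrePartition (2 * m),
          Γ.weight Q V : ℝ) : ℂ) := by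
    simp only [functional_prod_X hL hQs, sum_pairings_univ_eq hP, Finset.prod_mul_distrib,
      Finset.prod_const, hedges, Finset.mul_sum, Complex.ofReal_sum]
    rw [Finset.sum_comm]
    refine Finset.sum_congr rfl fun Γ hΓ => ?_
    rw [TrivalentGraph.weight, Complex.ofReal_sum, Finset.mul_sum]
    refine Finset.sum_congr rfl fun l _ => ?_
    rw [(Finset.mem_filter.1 hΓ).2, prod_fibrePartition V hV, Complex.ofReal_mul]
    push_cast
    ring
  rw [cubicPolynomial, ← MvPolynomial.smul_eq_C_mul, map_smul, map_sum]
  simp only [← MvPolynomial.smul_eq_C_mul, map_smul, smul_eq_mul]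
  rw [hsum, sum_vertices_weight_eq Q V m hcard hP]
  have hfac : ((2 * m).factorial : ℂ) ≠ 0 := by exact_mod_cast Nat.factorial_ne_zero _
  have h6 : (6 : ℂ) ^ (2 * m) ≠ 0 := pow_ne_zero _ (by norm_num)
  -- One factor i for each of the 2m vertices and one for each of the 3m edges, reduced by i⁴ = 1.
  have hI : Complex.I ^ (2 * m) * Complex.I ^ (3 * m) = Complex.I ^ m := by
    rw [← pow_add, show 2 * m + 3 * m = 4 * m + m by ring, pow_add, pow_mul, Complex.I_pow_four,
      one_pow, one_mul]
  rw [div_pow, ← hI]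
  push_cast
  field_simp

end Functional

theorem cubicTerm_eq_pow_mul (k : ℝ) (j : ℕ) (x : Fin N → ℝ) :
    cubicTerm V k j x = (k : ℂ) ^ j * cubicTerm V 1 j x := by
  simp only [cubicTerm, Complex.ofReal_one, mul_one]
  rw [mul_right_comm, mul_div_right_comm, mul_pow]
  ring

theorem cubicTerm_smul (k : ℝ) (j : ℕ) (t : ℝ) (x : Fin N → ℝ) :
    cubicTerm V k j (t • x) = (t : ℂ) ^ (3 * j) * cubicTerm V k j x := by
  have h : V (fun _ => t • x) = t ^ 3 * V fun _ => x := by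
    rw [V.map_smul_univ (fun _ => t) fun _ => x]
    simp
  simp only [cubicTerm, h]
  rw [pow_mul, ← mul_div_assoc, ← mul_pow]
  congr 2
  push_cast
  ring

theorem HasOscillatoryIntegral.const_mul {P : (Fin N → ℝ) → ℂ} {z : ℂ}
    (h : HasOscillatoryIntegral Q P z) (c : ℂ) :
    HasOscillatoryIntegral Q (fun x => c * P x) (c * z) := by
  refine ⟨fun ε hε => ?_, ?_⟩
  · simp only [mul_left_comm _ c]
    exact (h.1 ε hε).const_mul c
  · simp only [mul_left_comm _ c, integral_const_mul]
    exact h.2.const_mul c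

/-- It suffices to know the terms at k = 1: the j-th one has degree 3j, so scaling supplies
k^{-N/2-3j/2}, and the explicit k^j turns this into k^{-N/2-j/2}. -/
theorem isFormalIntegral_of_functional {L : MvPolynomial (Fin N) ℂ →ₗ[ℂ] ℂ}
    (hL : ∀ p, HasOscillatoryIntegral Q (polyFun p) (L p)) :
    IsFormalIntegral Q V ⟨-(N : ℝ) / 2, PowerSeries.mk fun j => L (cubicPolynomial V j)⟩ := by
  intro k hk j
  have h1 : HasOscillatoryIntegral Q (cubicTerm V 1 j) (L (cubicPolynomial V j)) := by
    have := hL (cubicPolynomial V j)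
    rwa [funext (polyFun_cubicPolynomial V j)] at this
  have h2 := (h1.smul (3 * j) (fun t x _ => cubicTerm_smul 1 j t x) hk).const_mul ((k : ℂ) ^ j)
  rw [← funext (cubicTerm_eq_pow_mul (V := V) k j)] at h2
  convert h2 using 1
  have hpow : k ^ (-(N : ℝ) / 2 - j / 2) =
      k ^ j * k ^ (-(N : ℝ) / 2 - ((3 * j : ℕ) : ℝ) / 2) := by
    rw [← Real.rpow_natCast k j, ← Real.rpow_add hk]
    congr 1
    push_cast
    ring
  rw [PowerSeries.coeff_mk, hpow]
  push_cast
  ring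

end Cubic

/-! ### Terms of order zero and the final assembly -/

theorem graphSum_zero {N : ℕ} (Q : LinearMap.BilinForm ℝ (Fin N → ℝ))
    (V : MultilinearMap ℝ (fun _ : Fin 3 => Fin N → ℝ) ℝ) : graphSum Q V 0 = 1 := by
  have h := totalWeight_fin Q V 0
  rw [Nat.mul_zero, Nat.factorial_zero, Nat.cast_one, one_mul] at h
  rw [← h, totalWeight]
  -- The empty graph is the only one here; its weight is an empty product summed over the single
  -- empty labeling.
  let Γ₀ : TrivalentGraph (Fin 0) :=
    ⟨∅, ∅, by simp, by simp, fun h => h.elim0, fun h => h.elim0⟩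
  have hu : ∀ Γ : TrivalentGraph (Fin 0), Γ = Γ₀ := by
    intro Γ
    have key : ∀ A : Finset (Finset (Fin 0)), (∀ s ∈ A, s.Nonempty) → A = ∅ := by
      intro A hA
      refine Finset.eq_empty_of_forall_notMem fun s hs => ?_
      obtain ⟨x, -⟩ := hA s hs
      exact x.elim0
    exact TrivalentGraph.ext_edges_vertices (key _ Γ.nonempty_of_mem_edges)
      (key _ Γ.nonempty_of_mem_vertices)
  rw [Finset.sum_eq_single Γ₀ (fun Γ _ h => absurd (hu Γ) h) (by simp)]
  simp [TrivalentGraph.weight, Γ₀]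

/-- The empty graph does not count as connected, which gives the logarithm its zero constant term.
-/
theorem connectedGraphSum_zero {N : ℕ} (Q : LinearMap.BilinForm ℝ (Fin N → ℝ))
    (V : MultilinearMap ℝ (fun _ : Fin 3 => Fin N → ℝ) ℝ) : connectedGraphSum Q V 0 = 0 := by
  classical
  rw [connectedGraphSum]
  refine Finset.sum_eq_zero fun γ hγ => ?_
  obtain ⟨Γ, rfl⟩ := GraphClass.mk_surjective γ
  have hc : Γ.Connected := (Finset.mem_filter.1 hγ).2
  obtain ⟨x⟩ := hc.1
  exact x.elim0

end FeynmanModel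

theorem mainTheorem1 (N : ℕ) (Q : LinearMap.BilinForm ℝ (Fin N → ℝ))
    (hQsymm : ∀ x y, Q x y = Q y x) (hQ : Q.Nondegenerate)
    (V : MultilinearMap ℝ (fun _ : Fin 3 => Fin N → ℝ) ℝ)
    (hV : ∀ (σ : Equiv.Perm (Fin 3)) (x : Fin 3 → Fin N → ℝ), V (fun r => x (σ r)) = V x) :
    ∃ (Z₀ : ℂ) (Z : FormalSeries),
      -- `Z₀` is the Gaussian integral `Z(0)` and `Z` is the formal integral `Z_k`
      HasOscillatoryIntegral Q (fun _ => 1) Z₀ ∧ Z₀ ≠ 0 ∧ IsFormalIntegral Q V Z ∧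
      -- the expansion of `Z_k` over trivalent graphs
      Z.exponent = -(N : ℝ) / 2 ∧
      (∀ m : ℕ, Z.series.coeff (2 * m + 1) = 0) ∧
      (∀ m : ℕ, Z.series.coeff (2 * m) = Complex.I ^ m * Z₀ * graphSum Q V m) ∧
      -- the number of gluings of the legs of `2m` fixed vertices which give the graph `Γ`
      (∀ (m : ℕ) (Γ : TrivalentGraph (Fin (6 * m))),
        (Nat.card {Δ : TrivalentGraph (Fin (6 * m)) //
            Δ.vertices = Γ.vertices ∧ ∃ σ : Equiv.Perm (Fin (6 * m)), Γ.IsIso Δ σ} : ℚ) =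
          (2 * m).factorial * 6 ^ (2 * m) / Nat.card Γ.Aut) ∧
      -- the expansion of `log (Z_k / Z(0))` over connected trivalent graphs
      PowerSeries.constantCoeff (Z.const_mul Z₀⁻¹).series = 1 ∧
      (Z.const_mul Z₀⁻¹).log.logCoeff = -(N : ℝ) / 2 ∧
      (∀ m : ℕ, (Z.const_mul Z₀⁻¹).log.series.coeff (2 * m + 1) = 0) ∧
      (∀ m : ℕ, (Z.const_mul Z₀⁻¹).log.series.coeff (2 * m) =
        Complex.I ^ m * connectedGraphSum Q V m) := by
  obtain ⟨L, hL1, hLint, hLX⟩ := exists_oscillatory_functional Q hQsymm hQ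
  set Z : FormalSeries :=
    ⟨-(N : ℝ) / 2, PowerSeries.mk fun j => L (cubicPolynomial V j)⟩ with hZ
  have hodd : ∀ m : ℕ, Z.series.coeff (2 * m + 1) = 0 := fun m => by
    rw [hZ, PowerSeries.coeff_mk]
    exact functional_cubicPolynomial_odd hLX hQsymm (by omega)
  have heven : ∀ m : ℕ, Z.series.coeff (2 * m) = Complex.I ^ m * L 1 * graphSum Q V m :=
    fun m => by
      rw [hZ, PowerSeries.coeff_mk]
      exact functional_cubicPolynomial_even hLX hQsymm hV m
  have hodd' : ∀ m : ℕ, (Z.const_mul (L 1)⁻¹).series.coeff (2 * m + 1) = 0 := fun m => by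
    rw [FormalSeries.const_mul, PowerSeries.coeff_C_mul, hodd, mul_zero]
  have heven' : ∀ m : ℕ, (Z.const_mul (L 1)⁻¹).series.coeff (2 * m) =
      Complex.I ^ m * graphSum Q V m := fun m => by
    rw [FormalSeries.const_mul, PowerSeries.coeff_C_mul, heven]
    field_simp
  obtain ⟨hlog1, hlog2⟩ := coeff_logOf_even
    (a := fun m => Complex.I ^ m * graphSum Q V m)
    (c := fun m => Complex.I ^ m * connectedGraphSum Q V m) hodd' heven'
    (by simp [graphSum_zero]) (by simp [connectedGraphSum_zero]) (fun m => by
      have h := congrArg Complex.ofReal (mul_graphSum Q V m)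
      push_cast at h
      rw [mul_left_comm, h, Finset.mul_sum]
      refine Finset.sum_congr rfl fun k hk => ?_
      have hkm : k ≤ m := Nat.lt_succ_iff.1 (Finset.mem_range.1 hk)
      -- Splitting i^m = i^k i^{m-k} shows that the recursion is compatible with the factors of i.
      conv_lhs => rw [← Nat.add_sub_cancel' hkm, pow_add, Nat.add_sub_cancel' hkm]
      ring)
  refine ⟨L 1, Z, ?_, hL1, isFormalIntegral_of_functional hLint, rfl, hodd, heven, ?_, ?_, rfl,
    hlog1, hlog2⟩
  · have := hLint 1
    have h1 : polyFun (1 : MvPolynomial (Fin N) ℂ) = fun _ => 1 := by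
      funext x
      simp [polyFun]
    rwa [h1] at this
  · intro m Γ
    have h := Γ.card_gluings_mul_card_aut
    have hc : Γ.vertices.card = 2 * m := by
      have := Γ.card_halfEdges
      rw [Fintype.card_fin] at this
      omega
    rw [hc] at h
    have hpos : (Nat.card Γ.Aut : ℚ) ≠ 0 := by exact_mod_cast Nat.card_pos.ne'
    rw [eq_div_iff hpos]
    exact_mod_cast h
  · rw [← PowerSeries.coeff_zero_eq_constantCoeff_apply]
    simpa [graphSum_zero] using heven' 0
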